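/- **Conventions.** Composition is written as juxtaposition, and in formulas the associativity and unit constraints of monoidal categories and the canonical isomorphisms ${}^\vee Y\otimes{}^\vee X\cong{}^\vee(X\otimes Y)$, $\mathbb 1\cong{}^\vee\mathbb 1$ and $X\cong({}^\vee X)^\vee$ are suppressed. Let $\mathcal C$ be a monoidal category in which every object $X$ has a left dual ${}^\vee X$, with $\mathrm{ev}_X\colon {}^\vee X\otimes X\to\mathbb 1$ and $\mathrm{coev}_X\colon\mathbb 1\to X\otimes{}^\vee X$, and a right dual $X^\vee$, with $\widetilde{\mathrm{ev}}_X\colon X\otimes X^\vee\to\mathbb 1$ and $\widetilde{\mathrm{coev}}_X\colon\mathbb 1\to X^\vee\otimes X$. Assume $\mathcal C$ is sovereign: it is endowed with a monoidal natural transformation $\phi\colon 1_{\mathcal C}\to{}^{\vee\vee}?$ (automatically invertible) to the double left dual functor. (The existence of right duals is automatic for a sovereign category.) A *bimonad* on $\mathcal C$ is a monad $(T,\mu,\eta)$ with a comonoidal structure $T_2(X,Y)\colon T(X\otimes Y)\to T(X)\otimes T(Y)$, $T_0\colon T(\mathbb 1)\to\mathbb 1$ on the functor $T$ such that $\mu$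 and $\eta$ are comonoidal. It is a *Hopf monad* if it has a left antipode, that is, a natural family $s^l_X\colon T({}^\vee T(X))\to{}^\vee X$ with $$T_0T(\mathrm{ev}_X)T({}^\vee\eta_X\otimes\mathrm{id}_X)=\mathrm{ev}_{T(X)}\bigl(s^l_{T(X)}T({}^\vee\mu_X)\otimes\mathrm{id}_{T(X)}\bigr)T_2({}^\vee T(X),X),$$ $$(\eta_X\otimes\mathrm{id}_{{}^\vee X})\mathrm{coev}_XT_0=(\mu_X\otimes s^l_X)T_2(T(X),{}^\vee T(X))T(\mathrm{coev}_{T(X)}),$$ and a right antipode, that is, a natural family $s^r_X\colon T(T(X)^\vee)\to X^\vee$ with $$T_0T(\widetilde{\mathrm{ev}}_X)T(\mathrm{id}_X\otimes\eta_X^\vee)=\widetilde{\mathrm{ev}}_{T(X)}\bigl(\mathrm{id}_{T(X)}\otimes s^r_{T(X)}T(\mu_X^\vee)\bigr)T_2(X,T(X)^\vee),$$ $$(\mathrm{id}_{X^\vee}\otimes\eta_X)\widetilde{\mathrm{coev}}_XT_0=(s^r_X\otimes\mu_X)T_2(T(X)^\vee,T(X))T(\widetilde{\mathrm{coev}}_{T(X)}).$$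 Let $\mathrm{Hom}(1_{\mathcal C},T)$ be the monoid of natural transformations $1_{\mathcal C}\to T$ under the convolution product $(a*b)_X=\mu_X\,a_{T(X)}\,b_X$, with unit $\eta$; inverses $a^{*-1}$ are taken in this monoid. For $a$ in it put $(L_a)_X=\mu_Xa_{T(X)}$ and $(R_a)_X=\mu_XT(a_X)$; call $a$ *central* if $L_a=R_a$, and for $a$ invertible put $\mathrm{ad}_a=L_aR_{a^{*-1}}$. Define $S\colon\mathrm{Hom}(1_{\mathcal C},T)\to\mathrm{Hom}(1_{\mathcal C},T)$ by $S(f)_X=(s^l_X\,f_{{}^\vee T(X)})^\vee$, and $S^2\colon T\to T$ by $S^2_X=\phi^{-1}_{T(X)}\,s^l_{{}^\vee T(X)}\,T({}^\vee(s^l_X))\,T(\phi_X)$. An element $g$ is *grouplike* if $T_2(X,Y)g_{X\otimes Y}=g_X\otimes g_Y$ and $T_0g_{\mathbb 1}=\mathrm{id}_{\mathbb 1}$ (it is then invertible). A *sovereign element* of $T$ is a grouplike element $G$ with $S^2=\mathrm{ad}_G$. An *R-matrix* for $T$ is a natural family $R_{X,Y}\colon X\otimes Y\to T(Y)\otimes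 T(X)$ that is convolution-invertible, that is, there is a natural family $Q_{X,Y}\colon Y\otimes X\to T(X)\otimes T(Y)$ with $(\mu_X\otimes\mu_Y)Q_{T(X),T(Y)}R_{X,Y}=\eta_X\otimes\eta_Y$ and $(\mu_Y\otimes\mu_X)R_{T(X),T(Y)}Q_{X,Y}=\eta_Y\otimes\eta_X$, and that satisfies $$(\mu_Y\otimes\mu_X)R_{T(X),T(Y)}T_2(X,Y)=(\mu_Y\otimes\mu_X)T_2(T(Y),T(X))T(R_{X,Y}),$$ $$(\mathrm{id}_{T(Z)}\otimes T_2(X,Y))R_{X\otimes Y,Z}=(\mu_Z\otimes\mathrm{id}_{T(X)\otimes T(Y)})(R_{X,T(Z)}\otimes\mathrm{id}_{T(Y)})(\mathrm{id}_X\otimes R_{Y,Z}),$$ $$(T_2(Y,Z)\otimes\mathrm{id}_{T(X)})R_{X,Y\otimes Z}=(\mathrm{id}_{T(Y)\otimes T(Z)}\otimes\mu_X)(\mathrm{id}_{T(Y)}\otimes R_{T(X),Z})(R_{X,Y}\otimes\mathrm{id}_Z).$$ A Hopf monad with an R-matrix is *quasitriangular*. Its *Drinfeld element* is $u\in\mathrm{Hom}(1_{\mathcal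 C},T)$, $$u_X=\bigl(\mathrm{ev}_{T(X)}(s^l_{T(X)}\otimes\mathrm{id}_{T(X)})R_{X,{}^\vee T^2(X)}\otimes\mu_X\phi^{-1}_{T^2(X)}\bigr)(\mathrm{id}_X\otimes\mathrm{coev}_{{}^\vee T^2(X)}).$$ A *twist* of $T$ is a central, invertible $\theta\in\mathrm{Hom}(1_{\mathcal C},T)$ with $$T_2(X,Y)\theta_{X\otimes Y}=(\mu_X\theta_{T(X)}\mu_X\otimes\mu_Y\theta_{T(Y)}\mu_Y)R_{T(Y),T(X)}R_{X,Y};$$ it is *self-dual* if $S(\theta)=\theta$. **Theorem.** Let $T$ be a quasitriangular Hopf monad on a sovereign category $\mathcal C$, with Drinfeld element $u$. Then $\theta\mapsto u*\theta$ is a bijection from the set of twists of $T$ onto the set of sovereign elements of $T$. Moreover, for every twist $\theta$, the element $G=u*\theta$ is invertible, and $\theta$ is self-dual if and only if $$S(u)=G^{*-1}*u*G^{*-1}.$$ -/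

import Mathlib

open CategoryTheory MonoidalCategory

universe v u

namespace HopfMonads

noncomputable section

/-! ### Duals

A left dual of `X` is an object `∨X` with `ev : ∨X ⊗ X ⟶ 𝟙` and `coev : 𝟙 ⟶ X ⊗ ∨X`; in Mathlib's
terminology this is a *right* dual (`ExactPairing X ∨X`). A right dual of `X` is an object `X∨`
with `ev : X ⊗ X∨ ⟶ 𝟙` and `coev : 𝟙 ⟶ X∨ ⊗ X`; in Mathlib's terminology this is a *left* dual. -/

section LeftDuals

variable {C : Type u} [Category.{v} C] [MonoidalCategory C] [RightRigidCategory C]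

/-- The chosen left dual `∨X`. -/
def lDual (X : C) : C := (RightRigidCategory.rightDual X).rightDual

/-- The chosen duality between `∨X` and `X`. -/

abbrev lPairing (X : C) : ExactPairing X (lDual X) := (RightRigidCategory.rightDual X).exact

/-- The evaluation `∨X ⊗ X ⟶ 𝟙`. -/
def lEv (X : C) : lDual X ⊗ X ⟶ 𝟙_ C := (lPairing X).evaluation'

/-- The coevaluation `𝟙 ⟶ X ⊗ ∨X`. -/
def lCoev (X : C) : 𝟙_ C ⟶ X ⊗ lDual X := (lPairing X).coevaluation'

/-- The left dual `∨f : ∨Y ⟶ ∨X` of a morphism `f : X ⟶ Y`. -/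
def lMap {X Y : C} (f : X ⟶ Y) : lDual Y ⟶ lDual X :=
  @rightAdjointMate C _ _ X Y (RightRigidCategory.rightDual X) (RightRigidCategory.rightDual Y) f

/-- The morphism `X ⟶ Y` which is in duality with a given `a : ∨Y ⟶ ∨X`, with respect to the
chosen dualities `(∨X, X)` and `(∨Y, Y)`. It is the right dual of `a`, with the canonical
isomorphisms `X ≅ (∨X)∨` and `Y ≅ (∨Y)∨` taken into account. -/
def lUnmap {X Y : C} (a : lDual Y ⟶ lDual X) : X ⟶ Y :=
  (λ_ X).inv ≫ lCoev Y ▷ X ≫ (α_ _ _ _).hom ≫ Y ◁ (a ▷ X ≫ lEv X) ≫ (ρ_ Y).hom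

/-- The canonical isomorphism `∨Y ⊗ ∨X ≅ ∨(X ⊗ Y)`. -/
def lDualTensorIso (X Y : C) : lDual Y ⊗ lDual X ≅ lDual (X ⊗ Y) :=
  rightDualIso (@ExactPairing.tensor C _ _ X Y _ _ (lPairing X) (lPairing Y)) (lPairing (X ⊗ Y))

/-- The canonical isomorphism `𝟙 ≅ ∨𝟙`. -/
def lDualUnitIso : 𝟙_ C ≅ lDual (𝟙_ C) :=
  rightDualIso exactPairingUnit (lPairing (𝟙_ C))

/-- The monoidal structure `∨∨X ⊗ ∨∨Y ⟶ ∨∨(X ⊗ Y)` of the double left dual functor. -/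
def llDualTensor (X Y : C) :
    lDual (lDual X) ⊗ lDual (lDual Y) ⟶ lDual (lDual (X ⊗ Y)) :=
  (lDualTensorIso (lDual Y) (lDual X)).hom ≫ lMap (lDualTensorIso X Y).inv

/-- The monoidal structure `𝟙 ⟶ ∨∨𝟙` of the double left dual functor. -/
def llDualUnit : 𝟙_ C ⟶ lDual (lDual (𝟙_ C)) :=
  lDualUnitIso.hom ≫ lMap lDualUnitIso.inv

theorem lMap_id (X : C) : lMap (𝟙 X) = 𝟙 (lDual X) :=
  @rightAdjointMate_id C _ _ X (RightRigidCategory.rightDual X)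

theorem lMap_comp {X Y Z : C} (f : X ⟶ Y) (g : Y ⟶ Z) : lMap (f ≫ g) = lMap g ≫ lMap f :=
  @comp_rightAdjointMate C _ _ X Y Z (RightRigidCategory.rightDual X)
    (RightRigidCategory.rightDual Y) (RightRigidCategory.rightDual Z) f g

theorem lCoev_lMap {X Y : C} (f : X ⟶ Y) : lCoev Y ≫ Y ◁ lMap f = lCoev X ≫ f ▷ lDual X :=
  @coevaluation_comp_rightAdjointMate C _ _ X Y (RightRigidCategory.rightDual X)
    (RightRigidCategory.rightDual Y) f

theorem lMap_lEv {X Y : C} (f : X ⟶ Y) : lMap f ▷ X ≫ lEv X = lDual Y ◁ f ≫ lEv Y :=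
  @rightAdjointMate_comp_evaluation C _ _ X Y (RightRigidCategory.rightDual X)
    (RightRigidCategory.rightDual Y) f

theorem zigzag_left (X : C) : lCoev X ▷ X ⊗≫ X ◁ lEv X = ⊗𝟙.hom :=
  @ExactPairing.evaluation_coevaluation'' C _ _ X (lDual X) (lPairing X)

theorem zigzag_right (X : C) : lDual X ◁ lCoev X ⊗≫ lEv X ▷ lDual X = ⊗𝟙.hom :=
  @ExactPairing.coevaluation_evaluation'' C _ _ X (lDual X) (lPairing X)

theorem lUnmap_lMap {X Y : C} (f : X ⟶ Y) : lUnmap (lMap f) = f := by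
  rw [lUnmap, lMap_lEv]
  calc
    _ = 𝟙 _ ⊗≫ (lCoev Y ▷ X ≫ (Y ⊗ lDual Y) ◁ f) ⊗≫ Y ◁ lEv Y ⊗≫ 𝟙 _ := by monoidal
    _ = f ⊗≫ (lCoev Y ▷ Y ⊗≫ Y ◁ lEv Y) ⊗≫ 𝟙 _ := by rw [← whisker_exchange]; monoidal
    _ = f := by rw [zigzag_left]; monoidal

theorem lUnmap_lEv {X Y : C} (a : lDual Y ⟶ lDual X) :
    lDual Y ◁ lUnmap a ≫ lEv Y = a ▷ X ≫ lEv X := by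
  rw [lUnmap]
  calc
    _ = 𝟙 _ ⊗≫ lDual Y ◁ lCoev Y ▷ X ⊗≫ ((lDual Y ⊗ Y) ◁ (a ▷ X ≫ lEv X) ≫ lEv Y ▷ 𝟙_ C)
          ⊗≫ 𝟙 _ := by monoidal
    _ = 𝟙 _ ⊗≫ (lDual Y ◁ lCoev Y ⊗≫ lEv Y ▷ lDual Y) ▷ X ⊗≫ (a ▷ X ≫ lEv X) := by
          rw [whisker_exchange]; monoidal
    _ = _ := by rw [zigzag_right]; monoidal

theorem ext_lEv {X Z : C} {a b : Z ⟶ lDual X} (h : a ▷ X ≫ lEv X = b ▷ X ≫ lEv X) : a = b := by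
  have key : ∀ c : Z ⟶ lDual X,
      c = 𝟙 _ ⊗≫ Z ◁ lCoev X ⊗≫ (c ▷ X ≫ lEv X) ▷ lDual X ⊗≫ 𝟙 _ := by
    intro c
    symm
    calc
      _ = 𝟙 _ ⊗≫ (Z ◁ lCoev X ≫ c ▷ (X ⊗ lDual X)) ⊗≫ lEv X ▷ lDual X ⊗≫ 𝟙 _ := by monoidal
      _ = c ⊗≫ (lDual X ◁ lCoev X ⊗≫ lEv X ▷ lDual X) ⊗≫ 𝟙 _ := by
            rw [whisker_exchange]; monoidal
      _ = c := by rw [zigzag_right]; monoidal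
  rw [key a, key b, h]

theorem lMap_lUnmap {X Y : C} (a : lDual Y ⟶ lDual X) : lMap (lUnmap a) = a :=
  ext_lEv (by rw [lMap_lEv, lUnmap_lEv])

theorem lMap_injective {X Y : C} {f g : X ⟶ Y} (h : lMap f = lMap g) : f = g := by
  rw [← lUnmap_lMap f, h, lUnmap_lMap]

theorem lDualTensorIso_lEv (X Y : C) :
    (lDualTensorIso X Y).hom ▷ (X ⊗ Y) ≫ lEv (X ⊗ Y) =
      𝟙 _ ⊗≫ lDual Y ◁ (lEv X ▷ Y) ⊗≫ lEv Y := by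
  have h := @rightAdjointMate_comp_evaluation C _ _ (X ⊗ Y) (X ⊗ Y)
    (RightRigidCategory.rightDual (X ⊗ Y))
    (@HasRightDual.mk C _ _ (X ⊗ Y) (lDual Y ⊗ lDual X)
      (@ExactPairing.tensor C _ _ X Y _ _ (lPairing X) (lPairing Y))) (𝟙 (X ⊗ Y))
  rw [MonoidalCategory.whiskerLeft_id, Category.id_comp] at h
  exact h

theorem lDualUnitIso_lEv :
    (lDualUnitIso (C := C)).hom ▷ 𝟙_ C ≫ lEv (𝟙_ C) = (ρ_ (𝟙_ C)).hom := by
  have h := @rightAdjointMate_comp_evaluation C _ _ (𝟙_ C) (𝟙_ C)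
    (RightRigidCategory.rightDual (𝟙_ C))
    (@HasRightDual.mk C _ _ (𝟙_ C) (𝟙_ C) exactPairingUnit) (𝟙 (𝟙_ C))
  rw [MonoidalCategory.whiskerLeft_id, Category.id_comp] at h
  exact h

theorem lMap_of_lEv (X : C) :
    lDualUnitIso.hom ≫ lMap (lEv X) = lCoev (lDual X) ≫ (lDualTensorIso (lDual X) X).hom := by
  apply ext_lEv
  rw [comp_whiskerRight, Category.assoc, lMap_lEv, comp_whiskerRight, Category.assoc,
    lDualTensorIso_lEv, ← whisker_exchange_assoc, lDualUnitIso_lEv]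
  calc
    _ = 𝟙 _ ⊗≫ lEv X ⊗≫ 𝟙 _ := by monoidal
    _ = 𝟙 _ ⊗≫ (lCoev (lDual X) ▷ lDual X ⊗≫ lDual X ◁ lEv (lDual X)) ▷ X ⊗≫ lEv X := by
          rw [zigzag_left]; monoidal
    _ = _ := by monoidal

theorem lMap_of_lCoev (X : C) :
    (lDualTensorIso X (lDual X)).hom ≫ lMap (lCoev X) = lEv (lDual X) ≫ lDualUnitIso.hom := by
  apply ext_lEv
  rw [comp_whiskerRight, Category.assoc, lMap_lEv, comp_whiskerRight, Category.assoc,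
    lDualUnitIso_lEv, ← whisker_exchange_assoc, lDualTensorIso_lEv]
  calc
    _ = 𝟙 _ ⊗≫ lDual (lDual X) ◁ (lDual X ◁ lCoev X ⊗≫ lEv X ▷ lDual X) ⊗≫ lEv (lDual X) := by
          monoidal
    _ = _ := by rw [zigzag_right]; monoidal

theorem llDualTensor_lEv (X : C) :
    llDualTensor (lDual X) X ≫ lMap (lMap (lEv X)) = lEv (lDual (lDual X)) ≫ llDualUnit := by
  have h : lMap (lEv X) ≫ (lDualTensorIso (lDual X) X).inv =
      lDualUnitIso.inv ≫ lCoev (lDual X) := by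
    rw [Iso.comp_inv_eq, Category.assoc, ← lMap_of_lEv, Iso.inv_hom_id_assoc]
  rw [llDualTensor, llDualUnit, Category.assoc, ← lMap_comp, h, lMap_comp, ← Category.assoc,
    lMap_of_lCoev, Category.assoc]

theorem lCoev_llDualTensor (X : C) :
    lCoev (lDual (lDual X)) ≫ llDualTensor X (lDual X) =
      llDualUnit ≫ lMap (lMap (lCoev X)) := by
  have h : lMap (lCoev X) ≫ lDualUnitIso.inv =
      (lDualTensorIso X (lDual X)).inv ≫ lEv (lDual X) := by
    rw [Iso.comp_inv_eq, Category.assoc, ← lMap_of_lCoev, Iso.inv_hom_id_assoc]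
  rw [llDualTensor, llDualUnit, Category.assoc, ← lMap_comp, h, lMap_comp, ← Category.assoc,
    ← lMap_of_lEv, Category.assoc]

theorem isIso_llDualTensor (X Y : C) : IsIso (llDualTensor X Y) := by
  have : IsIso (lMap (lDualTensorIso X Y).inv) :=
    ⟨lMap (lDualTensorIso X Y).hom, by rw [← lMap_comp, Iso.hom_inv_id, lMap_id],
      by rw [← lMap_comp, Iso.inv_hom_id, lMap_id]⟩
  unfold llDualTensor
  infer_instance

theorem isIso_llDualUnit : IsIso (llDualUnit : 𝟙_ C ⟶ _) := by
  have : IsIso (lMap (lDualUnitIso (C := C)).inv) :=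
    ⟨lMap lDualUnitIso.hom, by rw [← lMap_comp, Iso.hom_inv_id, lMap_id],
      by rw [← lMap_comp, Iso.inv_hom_id, lMap_id]⟩
  unfold llDualUnit
  infer_instance

end LeftDuals

section RightDuals

variable {C : Type u} [Category.{v} C] [MonoidalCategory C] [LeftRigidCategory C]

/-- The chosen right dual `X∨`. -/
def rDual (X : C) : C := (LeftRigidCategory.leftDual X).leftDual

/-- The chosen duality between `X` and `X∨`. -/
abbrev rPairing (X : C) : ExactPairing (rDual X) X := (LeftRigidCategory.leftDual X).exact

/-- The evaluation `X ⊗ X∨ ⟶ 𝟙`. -/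
def rEv (X : C) : X ⊗ rDual X ⟶ 𝟙_ C := (rPairing X).evaluation'

/-- The coevaluation `𝟙 ⟶ X∨ ⊗ X`. -/
def rCoev (X : C) : 𝟙_ C ⟶ rDual X ⊗ X := (rPairing X).coevaluation'

/-- The right dual `f∨ : Y∨ ⟶ X∨` of a morphism `f : X ⟶ Y`. -/
def rMap {X Y : C} (f : X ⟶ Y) : rDual Y ⟶ rDual X :=
  @leftAdjointMate C _ _ X Y (LeftRigidCategory.leftDual X) (LeftRigidCategory.leftDual Y) f

end RightDuals

/-! ### Sovereign structures -/

section Sovereign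

variable (C : Type u) [Category.{v} C] [MonoidalCategory C] [RightRigidCategory C]

/-- A sovereign structure, for the chosen left duals: a monoidal morphism `φ : 1 ⟶ ∨∨?` from the
identity functor to the double left dual functor. -/
structure SovereignStructure where
  app (X : C) : X ⟶ lDual (lDual X)
  naturality {X Y : C} (f : X ⟶ Y) : f ≫ app Y = app X ≫ lMap (lMap f)
  tensor (X Y : C) : app (X ⊗ Y) = (app X ⊗ₘ app Y) ≫ llDualTensor X Y
  unit : app (𝟙_ C) = llDualUnit

variable {C}

namespace SovereignStructure

variable (φ : SovereignStructure C)

theorem app_lEv (X : C) :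
    (φ.app (lDual X) ⊗ₘ φ.app X) ≫ lEv (lDual (lDual X)) = lEv X := by
  have h := φ.naturality (lEv X)
  rw [φ.tensor, φ.unit, Category.assoc, llDualTensor_lEv, ← Category.assoc] at h
  have := isIso_llDualUnit (C := C)
  exact ((cancel_mono _).1 h).symm

theorem lCoev_app (X : C) :
    lCoev X ≫ (φ.app X ⊗ₘ φ.app (lDual X)) = lCoev (lDual (lDual X)) := by
  have h := φ.naturality (lCoev X)
  rw [φ.tensor, φ.unit, ← lCoev_llDualTensor, ← Category.assoc] at h
  have := isIso_llDualTensor X (lDual X)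
  exact (cancel_mono _).1 h

/-- A sovereign structure is automatically an isomorphism. -/
instance isIso_app (X : C) : IsIso (φ.app X) := by
  refine ⟨𝟙 _ ⊗≫ lCoev X ▷ lDual (lDual X) ⊗≫
    X ◁ (φ.app (lDual X) ▷ lDual (lDual X) ≫ lEv (lDual (lDual X))) ⊗≫ 𝟙 _, ?_, ?_⟩
  · calc
      _ = 𝟙 _ ⊗≫ (𝟙_ C ◁ φ.app X ≫ lCoev X ▷ lDual (lDual X)) ⊗≫
          X ◁ (φ.app (lDual X) ▷ lDual (lDual X) ≫ lEv (lDual (lDual X))) ⊗≫ 𝟙 _ := by monoidal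
      _ = 𝟙 _ ⊗≫ lCoev X ▷ X ⊗≫
          X ◁ ((lDual X ◁ φ.app X ≫ φ.app (lDual X) ▷ lDual (lDual X)) ≫
            lEv (lDual (lDual X))) ⊗≫ 𝟙 _ := by
          rw [whisker_exchange]; monoidal
      _ = 𝟙 _ ⊗≫ (lCoev X ▷ X ⊗≫ X ◁ lEv X) ⊗≫ 𝟙 _ := by
          rw [← tensorHom_def', app_lEv]; monoidal
      _ = _ := by rw [zigzag_left]; monoidal
  · calc
      _ = 𝟙 _ ⊗≫ lCoev X ▷ lDual (lDual X) ⊗≫ X ◁ φ.app (lDual X) ▷ lDual (lDual X) ⊗≫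
          (X ◁ lEv (lDual (lDual X)) ≫ φ.app X ▷ 𝟙_ C) ⊗≫ 𝟙 _ := by monoidal
      _ = 𝟙 _ ⊗≫ (lCoev X ≫ (X ◁ φ.app (lDual X) ≫ φ.app X ▷ _)) ▷ lDual (lDual X) ⊗≫
          lDual (lDual X) ◁ lEv (lDual (lDual X)) ⊗≫ 𝟙 _ := by
          rw [whisker_exchange]; monoidal
      _ = 𝟙 _ ⊗≫ (lCoev (lDual (lDual X)) ▷ lDual (lDual X) ⊗≫
          lDual (lDual X) ◁ lEv (lDual (lDual X))) ⊗≫ 𝟙 _ := by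
          rw [← tensorHom_def', lCoev_app]; monoidal
      _ = _ := by rw [zigzag_left]; monoidal

theorem inv_naturality {X Y : C} (f : X ⟶ Y) :
    lMap (lMap f) ≫ inv (φ.app Y) = inv (φ.app X) ≫ f := by
  rw [IsIso.comp_inv_eq, Category.assoc, φ.naturality, IsIso.inv_hom_id_assoc]

end SovereignStructure

end Sovereign

/-! ### Convolution -/

section Convolution

variable {C : Type u} [Category.{v} C]

/-- The set `Hom(1, T)` of functorial morphisms from the identity functor to `T`. -/
abbrev HomUnit (T : Monad C) := 𝟭 C ⟶ T.toFunctor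

variable {T : Monad C}

theorem HomUnit.nat (a : HomUnit T) {X Y : C} (f : X ⟶ Y) :
    f ≫ a.app Y = a.app X ≫ T.map f := a.naturality f

/-- The element of `Hom(1, T)` with given components. -/
def HomUnit.ofApp (a : ∀ X : C, X ⟶ T.obj X)
    (h : ∀ {X Y : C} (f : X ⟶ Y), f ≫ a Y = a X ≫ T.map f) : HomUnit T where
  app := a
  naturality _ _ f := h f

/-- The convolution product, `(a * b)_X = μ_X a_{T X} b_X`. -/
def conv (a b : HomUnit T) : HomUnit T where
  app X := b.app X ≫ a.app (T.obj X) ≫ T.μ.app X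
  naturality X Y f := by
    have h := T.μ.naturality f
    dsimp at h ⊢
    rw [← Category.assoc, HomUnit.nat b f, Category.assoc, ← Category.assoc (T.map f),
      HomUnit.nat a (T.map f), Category.assoc, h]
    simp only [Category.assoc]

/-- `Hom(1, T)` is a monoid for the convolution product, with the unit of `T` as its unit. -/
instance : Monoid (HomUnit T) where
  mul := conv
  one := T.η
  mul_assoc a b c := by
    ext X
    change c.app X ≫ (b.app (T.obj X) ≫ a.app (T.obj (T.obj X)) ≫ T.μ.app (T.obj X)) ≫
      T.μ.app X = (c.app X ≫ b.app (T.obj X) ≫ T.μ.app X) ≫ a.app (T.obj X) ≫ T.μ.app X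
    have h : T.μ.app X ≫ a.app (T.obj X) = _ := HomUnit.nat a (T.μ.app X)
    simp only [Category.assoc]
    rw [← Category.assoc (T.μ.app X), h]
    simp only [Category.assoc]
    rw [T.assoc]
    rfl
  one_mul a := by
    ext X
    change a.app X ≫ T.η.app (T.obj X) ≫ T.μ.app X = a.app X
    rw [T.left_unit]
    exact Category.comp_id _
  mul_one a := by
    ext X
    change T.η.app X ≫ a.app (T.obj X) ≫ T.μ.app X = a.app X
    have h : T.η.app X ≫ a.app (T.obj X) = _ := HomUnit.nat a (T.η.app X)
    rw [← Category.assoc, h, Category.assoc, T.right_unit]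
    exact Category.comp_id _

theorem HomUnit.mul_app (a b : HomUnit T) (X : C) :
    (a * b).app X = b.app X ≫ a.app (T.obj X) ≫ T.μ.app X := rfl

theorem HomUnit.one_app (X : C) : (1 : HomUnit T).app X = T.η.app X := rfl

/-- `L_a : T ⟶ T`, with `(L_a)_X = μ_X a_{T X}`. -/
def Lact (a : HomUnit T) : T.toFunctor ⟶ T.toFunctor where
  app X := a.app (T.obj X) ≫ T.μ.app X
  naturality X Y f := by
    have h := T.μ.naturality f
    dsimp at h ⊢
    rw [← Category.assoc, HomUnit.nat a (T.map f), Category.assoc, h, Category.assoc]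

/-- `R_a : T ⟶ T`, with `(R_a)_X = μ_X T(a_X)`. -/
def Ract (a : HomUnit T) : T.toFunctor ⟶ T.toFunctor where
  app X := T.map (a.app X) ≫ T.μ.app X
  naturality X Y f := by
    have h := T.μ.naturality f
    dsimp at h ⊢
    rw [← Category.assoc, ← T.map_comp, HomUnit.nat a f, T.map_comp, Category.assoc, h,
      Category.assoc]

/-- A central element of `T`. -/
def IsCentral (a : HomUnit T) : Prop := Lact a = Ract a

/-- The adjoint action: `ad_a = L_a ∘ R_{a⁻¹}` for `a` invertible with respect to convolution. -/
def ad (a : (HomUnit T)ˣ) : T.toFunctor ⟶ T.toFunctor :=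
  Ract ((a⁻¹ : (HomUnit T)ˣ) : HomUnit T) ≫ Lact (a : HomUnit T)

end Convolution

/-! ### Bimonads and Hopf monads -/

section Bimonad

variable {C : Type u} [Category.{v} C] [MonoidalCategory C]

/-- A bimonad structure on a monad `T`: a comonoidal (that is, oplax monoidal) structure on the
functor `T`, such that the product and the unit of `T` are comonoidal. -/
class Bimonad (T : Monad C) where
  /-- The comonoidal structure of `T`. -/
  oplax : T.toFunctor.OplaxMonoidal
  mul_tensor (X Y : C) : T.μ.app (X ⊗ Y) ≫ oplax.δ X Y =
    T.map (oplax.δ X Y) ≫ oplax.δ (T.obj X) (T.obj Y) ≫ (T.μ.app X ⊗ₘ T.μ.app Y)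
  mul_unit : T.μ.app (𝟙_ C) ≫ oplax.η = T.map oplax.η ≫ oplax.η
  unit_tensor (X Y : C) : T.η.app (X ⊗ Y) ≫ oplax.δ X Y = (T.η.app X ⊗ₘ T.η.app Y)
  unit_unit : T.η.app (𝟙_ C) ≫ oplax.η = 𝟙 (𝟙_ C)

section

variable (T : Monad C) [Bimonad T]

/-- The comonoidal structure map `T₂(X, Y) : T(X ⊗ Y) ⟶ T(X) ⊗ T(Y)`. -/
def T₂ (X Y : C) : T.obj (X ⊗ Y) ⟶ T.obj X ⊗ T.obj Y :=
  (Bimonad.oplax (T := T)).δ X Y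

/-- The comonoidal structure map `T₀ : T(𝟙) ⟶ 𝟙`. -/
def T₀ : T.obj (𝟙_ C) ⟶ 𝟙_ C :=
  (Bimonad.oplax (T := T)).η

/-- A left antipode: a functorial morphism `T(∨T(X)) ⟶ ∨X` satisfying the two antipode axioms. -/
structure LeftAntipode [RightRigidCategory C] where
  app (X : C) : T.obj (lDual (T.obj X)) ⟶ lDual X
  naturality {X Y : C} (f : X ⟶ Y) :
    T.map (lMap (T.map f)) ≫ app X = app Y ≫ lMap f
  ev (X : C) :
    T.map (lMap (T.η.app X) ▷ X) ≫ T.map (lEv X) ≫ T₀ T =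
      T₂ T (lDual (T.obj X)) X ≫ (T.map (lMap (T.μ.app X)) ≫ app (T.obj X)) ▷ T.obj X ≫
        lEv (T.obj X)
  coev (X : C) :
    T₀ T ≫ lCoev X ≫ T.η.app X ▷ lDual X =
      T.map (lCoev (T.obj X)) ≫ T₂ T (T.obj X) (lDual (T.obj X)) ≫ (T.μ.app X ⊗ₘ app X)

/-- A right antipode: a functorial morphism `T(T(X)∨) ⟶ X∨` satisfying the two antipode axioms. -/
structure RightAntipode [LeftRigidCategory C] where
  app (X : C) : T.obj (rDual (T.obj X)) ⟶ rDual X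
  naturality {X Y : C} (f : X ⟶ Y) :
    T.map (rMap (T.map f)) ≫ app X = app Y ≫ rMap f
  ev (X : C) :
    T.map (X ◁ rMap (T.η.app X)) ≫ T.map (rEv X) ≫ T₀ T =
      T₂ T X (rDual (T.obj X)) ≫ T.obj X ◁ (T.map (rMap (T.μ.app X)) ≫ app (T.obj X)) ≫
        rEv (T.obj X)
  coev (X : C) :
    T₀ T ≫ rCoev X ≫ rDual X ◁ T.η.app X =
      T.map (rCoev (T.obj X)) ≫ T₂ T (rDual (T.obj X)) (T.obj X) ≫ (app X ⊗ₘ T.μ.app X)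

end

/-- A Hopf monad structure on a monad `T` on an autonomous (rigid) category: a bimonad structure
with a left antipode and a right antipode. -/
class HopfMonad [RigidCategory C] (T : Monad C) extends Bimonad T where
  leftAntipode : LeftAntipode T
  rightAntipode : RightAntipode T

/-- The left antipode `sˡ_X : T(∨T(X)) ⟶ ∨X` of a Hopf monad. -/
def sl [RigidCategory C] (T : Monad C) [HopfMonad T] (X : C) :
    T.obj (lDual (T.obj X)) ⟶ lDual X :=
  (HopfMonad.leftAntipode (T := T)).app X

theorem sl_naturality [RigidCategory C] (T : Monad C) [HopfMonad T] {X Y : C} (f : X ⟶ Y) :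
    T.map (lMap (T.map f)) ≫ sl T X = sl T Y ≫ lMap f :=
  (HopfMonad.leftAntipode (T := T)).naturality f

/-- An R-matrix for a bimonad `T`: a functorial morphism `R_{X,Y} : X ⊗ Y ⟶ T(Y) ⊗ T(X)` which is
invertible with respect to convolution and satisfies the three R-matrix axioms. -/
structure RMatrix (T : Monad C) [Bimonad T] where
  app (X Y : C) : X ⊗ Y ⟶ T.obj Y ⊗ T.obj X
  naturality {X X' Y Y' : C} (f : X ⟶ X') (g : Y ⟶ Y') :
    (f ⊗ₘ g) ≫ app X' Y' = app X Y ≫ (T.map g ⊗ₘ T.map f)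
  invertible : ∃ Q : ∀ X Y : C, Y ⊗ X ⟶ T.obj X ⊗ T.obj Y,
    (∀ {X X' Y Y' : C} (f : X ⟶ X') (g : Y ⟶ Y'),
      (g ⊗ₘ f) ≫ Q X' Y' = Q X Y ≫ (T.map f ⊗ₘ T.map g)) ∧
    (∀ X Y : C, app X Y ≫ Q (T.obj X) (T.obj Y) ≫ (T.μ.app X ⊗ₘ T.μ.app Y) =
      (T.η.app X ⊗ₘ T.η.app Y)) ∧
    (∀ X Y : C, Q X Y ≫ app (T.obj X) (T.obj Y) ≫ (T.μ.app Y ⊗ₘ T.μ.app X) =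
      (T.η.app Y ⊗ₘ T.η.app X))
  comm (X Y : C) :
    T₂ T X Y ≫ app (T.obj X) (T.obj Y) ≫ (T.μ.app Y ⊗ₘ T.μ.app X) =
      T.map (app X Y) ≫ T₂ T (T.obj Y) (T.obj X) ≫ (T.μ.app Y ⊗ₘ T.μ.app X)
  tensor_left (X Y Z : C) :
    app (X ⊗ Y) Z ≫ T.obj Z ◁ T₂ T X Y =
      (α_ X Y Z).hom ≫ X ◁ app Y Z ≫ (α_ X (T.obj Z) (T.obj Y)).inv ≫
        app X (T.obj Z) ▷ T.obj Y ≫ (α_ _ _ _).hom ≫ T.μ.app Z ▷ (T.obj X ⊗ T.obj Y)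
  tensor_right (X Y Z : C) :
    app X (Y ⊗ Z) ≫ T₂ T Y Z ▷ T.obj X =
      (α_ X Y Z).inv ≫ app X Y ▷ Z ≫ (α_ (T.obj Y) (T.obj X) Z).hom ≫
        T.obj Y ◁ app (T.obj X) Z ≫ (α_ _ _ _).inv ≫ (T.obj Y ⊗ T.obj Z) ◁ T.μ.app X

/-- A grouplike element of a bimonad. -/
structure IsGrouplike {T : Monad C} [Bimonad T] (g : HomUnit T) : Prop where
  tensor (X Y : C) : g.app (X ⊗ Y) ≫ T₂ T X Y = (g.app X ⊗ₘ g.app Y)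
  unit : g.app (𝟙_ C) ≫ T₀ T = 𝟙 (𝟙_ C)

/-- A twist of a quasitriangular bimonad: a central and convolution-invertible element `θ` of
`Hom(1, T)` with `T₂ θ_⊗ = (θ ⊗ θ) * R₂₁ * R`. -/
structure IsTwist {T : Monad C} [Bimonad T] (R : RMatrix T) (θ : HomUnit T) : Prop where
  central : IsCentral θ
  invertible : IsUnit θ
  tensor (X Y : C) : θ.app (X ⊗ Y) ≫ T₂ T X Y =
    R.app X Y ≫ R.app (T.obj Y) (T.obj X) ≫
      ((T.μ.app X ≫ θ.app (T.obj X) ≫ T.μ.app X) ⊗ₘ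
        (T.μ.app Y ≫ θ.app (T.obj Y) ≫ T.μ.app Y))

end Bimonad

section Hopf

variable {C : Type u} [Category.{v} C] [MonoidalCategory C] [RigidCategory C]
  {T : Monad C} [HopfMonad T]

/-- The map `S : Hom(1, T) ⟶ Hom(1, T)`, where `S(f)_X = (sˡ_X f_{∨T(X)})∨`, with the canonical
isomorphisms `X ≅ (∨X)∨` taken into account. -/
def S (f : HomUnit T) : HomUnit T :=
  HomUnit.ofApp (fun X => lUnmap (f.app (lDual (T.obj X)) ≫ sl T X)) fun {X Y} h => by
    apply lMap_injective
    have e : lMap (T.map h) ≫ f.app (lDual (T.obj X)) = _ := HomUnit.nat f (lMap (T.map h))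
    rw [lMap_comp, lMap_comp, lMap_lUnmap, lMap_lUnmap, ← Category.assoc, e, Category.assoc,
      Category.assoc, sl_naturality]

/-- A self-dual element: `S(θ) = θ`. -/
def IsSelfDual (θ : HomUnit T) : Prop := S θ = θ

theorem lMap_S_app (f : HomUnit T) (X : C) :
    lMap ((S f).app X) = f.app (lDual (T.obj X)) ≫ sl T X := lMap_lUnmap _

theorem coev_ext {X Y : C} {a b : X ⟶ Y} (h : lCoev X ≫ a ▷ lDual X = lCoev X ≫ b ▷ lDual X) :
    a = b := by
  have key : ∀ c : X ⟶ Y, c = 𝟙 _ ⊗≫ (lCoev X ≫ c ▷ lDual X) ▷ X ⊗≫ Y ◁ lEv X ⊗≫ 𝟙 _ := by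
    intro c
    symm
    calc
      _ = 𝟙 _ ⊗≫ lCoev X ▷ X ⊗≫ (c ▷ (lDual X ⊗ X) ≫ Y ◁ lEv X) ⊗≫ 𝟙 _ := by monoidal
      _ = 𝟙 _ ⊗≫ (lCoev X ▷ X ⊗≫ X ◁ lEv X) ⊗≫ c := by rw [← whisker_exchange]; monoidal
      _ = c := by rw [zigzag_left]; monoidal
  rw [key a, key b, h]

theorem ev_ext {X Y : C} {a b : X ⟶ Y} (h : lDual Y ◁ a ≫ lEv Y = lDual Y ◁ b ≫ lEv Y) :
    a = b :=
  lMap_injective (ext_lEv (by rw [lMap_lEv, lMap_lEv, h]))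

theorem IsGrouplike.mul_S {g : HomUnit T} (hg : IsGrouplike g) : g * S g = 1 := by
  ext X
  apply coev_ext
  rw [HomUnit.mul_app, HomUnit.one_app]
  have h := (HopfMonad.leftAntipode (T := T)).coev X
  have e : lCoev (T.obj X) ≫ g.app (T.obj X ⊗ lDual (T.obj X)) = _ :=
    HomUnit.nat g (lCoev (T.obj X))
  calc
    _ = lCoev (T.obj X) ≫ (g.app (T.obj X) ⊗ₘ g.app (lDual (T.obj X))) ≫
        (T.μ.app X ⊗ₘ sl T X) := by
      erw [comp_whiskerRight]
      rw [← Category.assoc]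
      erw [← lCoev_lMap ((S g).app X)]
      rw [lMap_S_app, Category.assoc, tensorHom_comp_tensorHom, tensorHom_def']
      rfl
    _ = g.app (𝟙_ C) ≫ T₀ T ≫ lCoev X ≫ T.η.app X ▷ lDual X := by
      rw [h, ← hg.tensor]
      erw [← Category.assoc (lCoev (T.obj X)), ← Category.assoc (lCoev (T.obj X)), e]
      simp only [Category.assoc]
      rfl
    _ = _ := by
      rw [← Category.assoc, hg.unit]
      exact Category.id_comp _

theorem IsGrouplike.S_mul {g : HomUnit T} (hg : IsGrouplike g) : S g * g = 1 := by
  ext X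
  apply ev_ext
  rw [HomUnit.mul_app, HomUnit.one_app]
  have h : _ = T₂ T (lDual (T.obj X)) X ≫ (T.map (lMap (T.μ.app X)) ≫ sl T (T.obj X)) ▷ T.obj X ≫
    lEv (T.obj X) := (HopfMonad.leftAntipode (T := T)).ev X
  have e1 : (lMap (T.η.app X) ▷ X ≫ lEv X) ≫ g.app (𝟙_ C) = _ :=
    HomUnit.nat g (lMap (T.η.app X) ▷ X ≫ lEv X)
  have e2 : lMap (T.μ.app X) ≫ g.app (lDual (T.obj (T.obj X))) = _ :=
    HomUnit.nat g (lMap (T.μ.app X))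
  have e3 : lMap ((S g).app (T.obj X)) = g.app (lDual (T.obj (T.obj X))) ≫ sl T (T.obj X) :=
    lMap_S_app g (T.obj X)
  have e4 : lMap ((S g).app (T.obj X) ≫ T.μ.app X) =
      g.app (lDual (T.obj X)) ≫ T.map (lMap (T.μ.app X)) ≫ sl T (T.obj X) := by
    erw [lMap_comp]
    rw [e3]
    erw [← Category.assoc, e2]
    rw [Category.assoc]
  have e5 : lMap ((S g).app (T.obj X) ≫ T.μ.app X) ▷ T.obj X ≫ lEv (T.obj X) =
      lDual (T.obj X) ◁ ((S g).app (T.obj X) ≫ T.μ.app X) ≫ lEv (T.obj X) := lMap_lEv _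
  have e6 : lMap (T.η.app X) ▷ X ≫ lEv X = lDual (T.obj X) ◁ T.η.app X ≫ lEv (T.obj X) :=
    lMap_lEv _
  have e7 := hg.tensor (lDual (T.obj X)) X
  calc
    lDual (T.obj X) ◁ (g.app X ≫ (S g).app (T.obj X) ≫ T.μ.app X) ≫ lEv (T.obj X)
      = (g.app (lDual (T.obj X)) ⊗ₘ g.app X) ≫
          (T.map (lMap (T.μ.app X)) ≫ sl T (T.obj X)) ▷ T.obj X ≫ lEv (T.obj X) := by
        rw [MonoidalCategory.whiskerLeft_comp, Category.assoc]
        erw [← e5]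
        rw [e4, tensorHom_def', comp_whiskerRight]
        simp only [Category.assoc]
        rfl
    _ = g.app (lDual (T.obj X) ⊗ X) ≫ T.map (lMap (T.η.app X) ▷ X ≫ lEv X) ≫ T₀ T := by
        rw [← e7, Category.assoc, ← h, T.map_comp, Category.assoc]
    _ = (lMap (T.η.app X) ▷ X ≫ lEv X) ≫ g.app (𝟙_ C) ≫ T₀ T := by
        rw [← Category.assoc, ← Category.assoc, ← e1]
    _ = lDual (T.obj X) ◁ T.η.app X ≫ lEv (T.obj X) := by
        rw [hg.unit]
        erw [Category.comp_id]
        exact e6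

/-- A grouplike element of a Hopf monad is invertible with respect to convolution. -/
def IsGrouplike.toUnit {g : HomUnit T} (hg : IsGrouplike g) : (HomUnit T)ˣ :=
  ⟨g, S g, hg.mul_S, hg.S_mul⟩

section

variable (φ : SovereignStructure C)

variable (T) in
/-- The square of the antipode,
`S²_X = φ⁻¹_{T(X)} sˡ_{∨T(X)} T(∨(sˡ_X)) T(φ_X)`. -/
def Ssq : T.toFunctor ⟶ T.toFunctor where
  app X := T.map (φ.app X) ≫ T.map (lMap (sl T X)) ≫ sl T (lDual (T.obj X)) ≫
    inv (φ.app (T.obj X))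
  naturality X Y f := by
    have h1 := sl_naturality T f
    have h2 := sl_naturality T (lMap (T.map f))
    have h3 := φ.inv_naturality (T.map f)
    simp only [Category.assoc]
    rw [← Category.assoc (T.map f), ← T.map_comp, φ.naturality, T.map_comp, Category.assoc,
      ← Category.assoc (T.map (lMap (lMap f))), ← T.map_comp, ← lMap_comp, ← h1, lMap_comp,
      T.map_comp, Category.assoc, ← Category.assoc (T.map (lMap (T.map (lMap (T.map f))))), h2,
      Category.assoc, h3]

/-- A sovereign element of a Hopf monad on a sovereign category: a grouplike element `G` such that
`S² = ad_G`. -/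
structure IsSovereignElement (G : HomUnit T) : Prop where
  grouplike : IsGrouplike G
  sq : Ssq T φ = ad grouplike.toUnit

variable (R : RMatrix T)

/-- The first factor `ev_{T(X)} (sˡ_{T(X)} ⊗ id) R_{X, ∨T²(X)} : X ⊗ ∨T²(X) ⟶ 𝟙` in the
definition of the Drinfeld element. -/
def drinfeldPairing (X : C) : X ⊗ lDual (T.obj (T.obj X)) ⟶ 𝟙_ C :=
  R.app X (lDual (T.obj (T.obj X))) ≫ sl T (T.obj X) ▷ T.obj X ≫ lEv (T.obj X)

theorem drinfeldPairing_nat {X Y : C} (f : X ⟶ Y) :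
    f ▷ lDual (T.obj (T.obj Y)) ≫ drinfeldPairing R Y =
      X ◁ lMap (T.map (T.map f)) ≫ drinfeldPairing R X := by
  unfold drinfeldPairing
  have h1 := R.naturality f (𝟙 (lDual (T.obj (T.obj Y))))
  have h2 := R.naturality (𝟙 X) (lMap (T.map (T.map f)))
  rw [T.map_id, tensorHom_id, id_tensorHom] at h1
  rw [T.map_id, tensorHom_id, id_tensorHom] at h2
  rw [← Category.assoc, h1, ← Category.assoc (X ◁ _), h2, Category.assoc, Category.assoc,
    ← comp_whiskerRight_assoc, sl_naturality, comp_whiskerRight_assoc, lMap_lEv,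
    whisker_exchange_assoc]

/-- The Drinfeld element of a quasitriangular Hopf monad on a sovereign category,
`u_X = (ev_{T(X)} (sˡ_{T(X)} ⊗ id) R_{X, ∨T²(X)} ⊗ μ_X φ⁻¹_{T²(X)}) (id_X ⊗ coev_{∨T²(X)})`. -/
def drinfeld : HomUnit T :=
  HomUnit.ofApp
    (fun X => (ρ_ X).inv ≫ X ◁ lCoev (lDual (T.obj (T.obj X))) ≫ (α_ _ _ _).inv ≫
      (drinfeldPairing R X ⊗ₘ (inv (φ.app (T.obj (T.obj X))) ≫ T.μ.app X)) ≫
        (λ_ (T.obj X)).hom)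
    fun {X Y} f => by
      have hμ : T.map (T.map f) ≫ T.μ.app Y = T.μ.app X ≫ T.map f := T.μ.naturality f
      have hφ : lMap (lMap (T.map (T.map f))) ≫ inv (φ.app (T.obj (T.obj Y))) ≫ T.μ.app Y =
          (inv (φ.app (T.obj (T.obj X))) ≫ T.μ.app X) ≫ T.map f := by
        rw [← Category.assoc, φ.inv_naturality, Category.assoc, hμ, Category.assoc]
      have hd := drinfeldPairing_nat R f
      have hc := lCoev_lMap (lMap (T.map (T.map f)))
      generalize inv (φ.app (T.obj (T.obj Y))) ≫ T.μ.app Y = q at *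
      generalize inv (φ.app (T.obj (T.obj X))) ≫ T.μ.app X = p at *
      generalize drinfeldPairing R X = d at *
      generalize drinfeldPairing R Y = e at *
      generalize lMap (T.map (T.map f)) = m at *
      calc
        _ = 𝟙 _ ⊗≫ (f ▷ 𝟙_ C ≫ Y ◁ lCoev (lDual (T.obj (T.obj Y)))) ⊗≫ (e ⊗ₘ q) ⊗≫ 𝟙 _ := by
          monoidal
        _ = 𝟙 _ ⊗≫ X ◁ lCoev (lDual (T.obj (T.obj Y))) ⊗≫
            (f ▷ lDual (T.obj (T.obj Y)) ≫ e) ▷ lDual (lDual (T.obj (T.obj Y))) ⊗≫ q ⊗≫ 𝟙 _ := by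
          rw [← whisker_exchange, MonoidalCategory.tensorHom_def]; monoidal
        _ = 𝟙 _ ⊗≫ X ◁ (lCoev (lDual (T.obj (T.obj Y))) ≫ m ▷ lDual (lDual (T.obj (T.obj Y)))) ⊗≫
            d ▷ lDual (lDual (T.obj (T.obj Y))) ⊗≫ q ⊗≫ 𝟙 _ := by
          rw [hd]; monoidal
        _ = 𝟙 _ ⊗≫ X ◁ lCoev (lDual (T.obj (T.obj X))) ⊗≫
            ((X ⊗ lDual (T.obj (T.obj X))) ◁ lMap m ≫ d ▷ lDual (lDual (T.obj (T.obj Y)))) ⊗≫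
              q ⊗≫ 𝟙 _ := by
          rw [← hc]; monoidal
        _ = 𝟙 _ ⊗≫ X ◁ lCoev (lDual (T.obj (T.obj X))) ⊗≫
            d ▷ lDual (lDual (T.obj (T.obj X))) ⊗≫ (lMap m ≫ q) ⊗≫ 𝟙 _ := by
          rw [whisker_exchange]; monoidal
        _ = _ := by
          rw [hφ, MonoidalCategory.tensorHom_def]; monoidal

end

end Hopf

end

end HopfMonads

open HopfMonads

/-!
Elements of `Hom(1, T)` are the same as endomorphisms of the forgetful functor from `T`-modules to
`C`: an element `a` acts on a module `(A, r)` by `r a_A` (`act`), it is recovered from its action on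
free modules (`η_act_free`, `HomUnit.ofForget`), and convolution becomes composition (`act_mul`).
All the assertions are therefore proved for the category of modules.

The bimonad structure makes this category monoidal, the left antipode gives every module a left dual
(`dualModule`), and an R-matrix gives a braiding (`braidedModules`); the forgetful functor strictly
preserves tensor products and left duals. In any braided category with left duals there is the
Drinfeld isomorphism `X ≅ ∨∨X`, which is natural (`drinfeldIso_naturality`) and is monoidal up to
the double braiding (`drinfeldIso_tensor`). For modules, composing it with `φ⁻¹` gives an
automorphism of the forgetful functor, and the corresponding element of `Hom(1, T)` is the Drinfeld
element `u` (`drinfeld_eq_ofForget`). Hence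

* `u` is invertible (`isUnit_drinfeld`), because the Drinfeld isomorphism is one;
* `R_u S² = L_u` (`Ssq_comp_Ract_drinfeld`), because the Drinfeld isomorphism of a free module is
  `T`-linear; so `R_{u * θ} S² = L_{u * θ}` exactly when `θ` is central (`comp_Ract_mul_iff`);
* `u` composed with the double braiding of `M ⊗ N` is the tensor product of its actions on `M` and
  `N` (`act_drinfeld_tensor`); so, for central `θ`, the element `u * θ` is multiplicative on
  tensor products exactly when `θ` satisfies the tensor axiom of a twist (`twist_iff_grouplike`).

For an invertible element the counit condition in the definition of grouplike elements is a
consequence of the other one (`isGrouplike_of_tensor`). This gives the bijection.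

For the last assertion, `S` reverses convolution products because `S(f)` acts on a module as the
transpose of the action of `f` on its dual (`lMap_act_S`), and `S(G) = G⁻¹` for grouplike `G`; with
`G = u * θ` the criterion is then a computation in a monoid (`isSelfDual_iff`).
-/

namespace HopfMonads

noncomputable section

/-! ### The Drinfeld isomorphism of a braided category -/

section BraidedDrinfeld

variable {D : Type u} [Category.{v} D] [MonoidalCategory D] [BraidedCategory D]
  [RightRigidCategory D]

/-- The Drinfeld isomorphism `X ≅ ∨∨X` of a braided category with left duals: both `X` (through the
braiding) and `∨∨X` are left duals of `∨X`. -/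
def drinfeldIso (X : D) : X ≅ lDual (lDual X) :=
  rightDualIso (@BraidedCategory.exactPairing_swap D _ _ _ X (lDual X) (lPairing X))
    (lPairing (lDual X))

/-- The evaluation of `X` against `∨X` through the braiding. -/
def braidedEv (X : D) : X ⊗ lDual X ⟶ 𝟙_ D := (β_ X (lDual X)).hom ≫ lEv X

theorem drinfeldIso_lEv (X : D) :
    (drinfeldIso X).hom ▷ lDual X ≫ lEv (lDual X) = braidedEv X := by
  have h := @rightAdjointMate_comp_evaluation D _ _ (lDual X) (lDual X)
    (RightRigidCategory.rightDual (lDual X))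
    (@HasRightDual.mk D _ _ (lDual X) X
      (@BraidedCategory.exactPairing_swap D _ _ _ X (lDual X) (lPairing X))) (𝟙 (lDual X))
  rw [MonoidalCategory.whiskerLeft_id, Category.id_comp] at h
  exact h

/-- The Drinfeld isomorphism in terms of evaluation and coevaluation, in the shape of the definition
of the Drinfeld element. -/
theorem drinfeldIso_eq (X : D) :
    (drinfeldIso X).hom = (ρ_ X).inv ≫ X ◁ lCoev (lDual X) ≫ (α_ _ _ _).inv ≫
      braidedEv X ▷ lDual (lDual X) ≫ (λ_ _).hom := by
  symm
  rw [← drinfeldIso_lEv]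
  generalize (drinfeldIso X).hom = d
  calc
    _ = 𝟙 _ ⊗≫ (X ◁ lCoev (lDual X) ≫ d ▷ (lDual X ⊗ lDual (lDual X))) ⊗≫
          lEv (lDual X) ▷ lDual (lDual X) ⊗≫ 𝟙 _ := by monoidal
    _ = d ⊗≫ (lDual (lDual X) ◁ lCoev (lDual X) ⊗≫ lEv (lDual X) ▷ lDual (lDual X)) ⊗≫ 𝟙 _ := by
          rw [whisker_exchange]; monoidal
    _ = d := by rw [zigzag_right]; monoidal

theorem drinfeldIso_naturality {X Y : D} (f : X ⟶ Y) :
    f ≫ (drinfeldIso Y).hom = (drinfeldIso X).hom ≫ lMap (lMap f) := by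
  apply ext_lEv
  rw [comp_whiskerRight, Category.assoc, drinfeldIso_lEv, comp_whiskerRight, Category.assoc,
    lMap_lEv, ← whisker_exchange_assoc, drinfeldIso_lEv, braidedEv, braidedEv,
    BraidedCategory.braiding_naturality_left_assoc,
    BraidedCategory.braiding_naturality_right_assoc, lMap_lEv]

omit [BraidedCategory D] in
theorem llDualTensor_lEv_tensor (X Y : D) :
    (llDualTensor X Y) ▷ lDual (X ⊗ Y) ≫ lEv (lDual (X ⊗ Y)) =
      (lDual (lDual X) ⊗ lDual (lDual Y)) ◁ (lDualTensorIso X Y).inv ⊗≫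
        lDual (lDual X) ◁ (lEv (lDual Y) ▷ lDual X) ⊗≫ lEv (lDual X) := by
  rw [llDualTensor, comp_whiskerRight, Category.assoc, lMap_lEv, ← whisker_exchange_assoc,
    lDualTensorIso_lEv]
  monoidal

/-- A strand `Y` slides past the braided evaluation of `X`. -/
theorem braiding_braidedEv (X Y : D) :
    (β_ Y X).hom ▷ lDual X ⊗≫ X ◁ (β_ Y (lDual X)).hom ⊗≫ braidedEv X ▷ Y =
      𝟙 _ ⊗≫ Y ◁ braidedEv X ⊗≫ 𝟙 _ := by
  have h := BraidedCategory.braiding_naturality_right Y (braidedEv X)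
  rw [BraidedCategory.braiding_tensor_right_hom] at h
  calc
    _ = 𝟙 _ ⊗≫ ((α_ Y X (lDual X)).inv ≫ (β_ Y X).hom ▷ lDual X ≫ (α_ X Y (lDual X)).hom ≫
          X ◁ (β_ Y (lDual X)).hom ≫ (α_ X (lDual X) Y).inv) ≫ braidedEv X ▷ Y ⊗≫ 𝟙 _ := by
        monoidal
    _ = 𝟙 _ ⊗≫ (Y ◁ braidedEv X ≫ (β_ Y (𝟙_ D)).hom) ⊗≫ 𝟙 _ := by
        rw [h]; simp only [Category.assoc, monoidalComp]
    _ = _ := by rw [braiding_tensorUnit_right]; monoidal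

/-- The braided evaluation of `X ⊗ Y`, preceded by the double braiding, is nested from those of `X`
and `Y`. -/
theorem braidedEv_tensor (X Y : D) :
    (β_ X Y).hom ▷ lDual (X ⊗ Y) ≫ (β_ Y X).hom ▷ lDual (X ⊗ Y) ≫ braidedEv (X ⊗ Y) =
      (X ⊗ Y) ◁ (lDualTensorIso X Y).inv ⊗≫ X ◁ (braidedEv Y ▷ lDual X) ⊗≫ braidedEv X := by
  have h1 : braidedEv (X ⊗ Y) = (X ⊗ Y) ◁ (lDualTensorIso X Y).inv ≫
      (β_ (X ⊗ Y) (lDual Y ⊗ lDual X)).hom ⊗≫ lDual Y ◁ (lEv X ▷ Y) ⊗≫ lEv Y := by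
    rw [braidedEv, ← Iso.inv_hom_id_assoc (whiskerLeftIso (X ⊗ Y) (lDualTensorIso X Y))
      ((β_ (X ⊗ Y) (lDual (X ⊗ Y))).hom ≫ _)]
    rw [whiskerLeftIso_hom, whiskerLeftIso_inv, BraidedCategory.braiding_naturality_right_assoc,
      lDualTensorIso_lEv]
    simp [monoidalComp]
  have h2 : (β_ (X ⊗ Y) (lDual Y ⊗ lDual X)).hom ⊗≫ lDual Y ◁ (lEv X ▷ Y) ⊗≫ lEv Y =
      𝟙 _ ⊗≫ (β_ (X ⊗ Y) (lDual Y)).hom ▷ lDual X ⊗≫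
        lDual Y ◁ (X ◁ (β_ Y (lDual X)).hom ⊗≫ braidedEv X ▷ Y) ⊗≫ lEv Y := by
    rw [BraidedCategory.braiding_tensor_right_hom,
      BraidedCategory.braiding_tensor_left_hom X Y (lDual X), braidedEv]
    monoidal
  have h3 := braiding_braidedEv X Y
  have h4 := braiding_braidedEv Y X
  rw [h1, h2]
  calc
    _ = (X ⊗ Y) ◁ (lDualTensorIso X Y).inv ⊗≫ (β_ X Y).hom ▷ (lDual Y ⊗ lDual X) ⊗≫
        ((β_ Y X).hom ▷ lDual Y ≫ (β_ (X ⊗ Y) (lDual Y)).hom) ▷ lDual X ⊗≫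
        lDual Y ◁ (X ◁ (β_ Y (lDual X)).hom ⊗≫ braidedEv X ▷ Y) ⊗≫ lEv Y := by
      rw [← whisker_exchange_assoc, ← whisker_exchange_assoc]; monoidal
    _ = (X ⊗ Y) ◁ (lDualTensorIso X Y).inv ⊗≫ (β_ X Y).hom ▷ (lDual Y ⊗ lDual X) ⊗≫
        (β_ (Y ⊗ X) (lDual Y)).hom ▷ lDual X ⊗≫
        lDual Y ◁ ((β_ Y X).hom ▷ lDual X ⊗≫ X ◁ (β_ Y (lDual X)).hom ⊗≫ braidedEv X ▷ Y) ⊗≫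
        lEv Y := by
      rw [BraidedCategory.braiding_naturality_left]; monoidal
    _ = (X ⊗ Y) ◁ (lDualTensorIso X Y).inv ⊗≫ (β_ X Y).hom ▷ (lDual Y ⊗ lDual X) ⊗≫
        Y ◁ (β_ X (lDual Y)).hom ▷ lDual X ⊗≫
        (β_ Y (lDual Y)).hom ▷ (X ⊗ lDual X) ⊗≫
        ((lDual Y ⊗ Y) ◁ braidedEv X ≫ lEv Y ▷ 𝟙_ D) ⊗≫ 𝟙 _ := by
      rw [h3, BraidedCategory.braiding_tensor_left_hom]; monoidal
    _ = (X ⊗ Y) ◁ (lDualTensorIso X Y).inv ⊗≫ ((β_ X Y).hom ▷ lDual Y ⊗≫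
        Y ◁ (β_ X (lDual Y)).hom ⊗≫
        braidedEv Y ▷ X) ▷ lDual X ⊗≫ braidedEv X := by
      rw [whisker_exchange, braidedEv, braidedEv]; monoidal
    _ = _ := by rw [h4]; monoidal

/-- The Drinfeld isomorphism is monoidal up to the double braiding. -/
theorem drinfeldIso_tensor (X Y : D) :
    (β_ X Y).hom ≫ (β_ Y X).hom ≫ (drinfeldIso (X ⊗ Y)).hom =
      ((drinfeldIso X).hom ⊗ₘ (drinfeldIso Y).hom) ≫ llDualTensor X Y := by
  apply ext_lEv
  rw [comp_whiskerRight, comp_whiskerRight, Category.assoc, Category.assoc, drinfeldIso_lEv,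
    comp_whiskerRight, Category.assoc, llDualTensor_lEv_tensor, braidedEv_tensor,
    ← drinfeldIso_lEv, ← drinfeldIso_lEv]
  generalize (drinfeldIso X).hom = d
  generalize (drinfeldIso Y).hom = e
  calc
    _ = (X ⊗ Y) ◁ (lDualTensorIso X Y).inv ⊗≫
        (X ◁ (e ▷ lDual Y ≫ lEv (lDual Y)) ≫ d ▷ 𝟙_ D) ▷ lDual X ⊗≫ lEv (lDual X) := by
      monoidal
    _ = ((X ⊗ Y) ◁ (lDualTensorIso X Y).inv ≫ (d ⊗ₘ e) ▷ (lDual Y ⊗ lDual X)) ⊗≫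
        (lDual (lDual X) ◁ lEv (lDual Y)) ▷ lDual X ⊗≫ lEv (lDual X) := by
      rw [whisker_exchange, MonoidalCategory.tensorHom_def]; monoidal
    _ = _ := by rw [whisker_exchange]; monoidal

end BraidedDrinfeld

/-! ### The monoidal category of modules over a bimonad -/

section Modules

variable {C : Type u} [Category.{v} C] [MonoidalCategory C] {T : Monad C}

theorem T₂_nat (T : Monad C) [Bimonad T] {X X' Y Y' : C} (f : X ⟶ X') (g : Y ⟶ Y') :
    T.map (f ⊗ₘ g) ≫ T₂ T X' Y' = T₂ T X Y ≫ (T.map f ⊗ₘ T.map g) :=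
  letI := Bimonad.oplax (T := T)
  (Functor.OplaxMonoidal.δ_natural T.toFunctor f g).symm

theorem T₂_nat_left (T : Monad C) [Bimonad T] {X X' : C} (f : X ⟶ X') (Y : C) :
    T.map (f ▷ Y) ≫ T₂ T X' Y = T₂ T X Y ≫ T.map f ▷ T.obj Y :=
  ((Bimonad.oplax (T := T)).δ_natural_left f Y).symm

theorem T₂_nat_right (T : Monad C) [Bimonad T] (X : C) {Y Y' : C} (f : Y ⟶ Y') :
    T.map (X ◁ f) ≫ T₂ T X Y' = T₂ T X Y ≫ T.obj X ◁ T.map f :=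
  ((Bimonad.oplax (T := T)).δ_natural_right X f).symm

theorem T₂_assoc (T : Monad C) [Bimonad T] (X Y Z : C) :
    T₂ T (X ⊗ Y) Z ≫ T₂ T X Y ▷ T.obj Z ≫ (α_ _ _ _).hom =
      T.map (α_ X Y Z).hom ≫ T₂ T X (Y ⊗ Z) ≫ T.obj X ◁ T₂ T Y Z :=
  (Bimonad.oplax (T := T)).oplax_associativity X Y Z

theorem T₂_left_unit (T : Monad C) [Bimonad T] (X : C) :
    T.map (λ_ X).hom = T₂ T (𝟙_ C) X ≫ T₀ T ▷ T.obj X ≫ (λ_ (T.obj X)).hom := by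
  have h : (λ_ (T.obj X)).inv = T.map (λ_ X).inv ≫ T₂ T (𝟙_ C) X ≫ T₀ T ▷ T.obj X :=
    (Bimonad.oplax (T := T)).oplax_left_unitality X
  rw [← cancel_epi (T.map (λ_ X).inv), ← T.map_comp, Iso.inv_hom_id, T.map_id,
    ← Category.assoc (T₂ T _ _), ← Category.assoc (T.map _), ← h, Iso.inv_hom_id]

theorem T₂_right_unit (T : Monad C) [Bimonad T] (X : C) :
    T.map (ρ_ X).hom = T₂ T X (𝟙_ C) ≫ T.obj X ◁ T₀ T ≫ (ρ_ (T.obj X)).hom := by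
  have h : (ρ_ (T.obj X)).inv = T.map (ρ_ X).inv ≫ T₂ T X (𝟙_ C) ≫ T.obj X ◁ T₀ T :=
    (Bimonad.oplax (T := T)).oplax_right_unitality X
  rw [← cancel_epi (T.map (ρ_ X).inv), ← T.map_comp, Iso.inv_hom_id, T.map_id,
    ← Category.assoc (T₂ T _ _), ← Category.assoc (T.map _), ← h, Iso.inv_hom_id]

theorem μ_T₂ (T : Monad C) [Bimonad T] (X Y : C) : T.μ.app (X ⊗ Y) ≫ T₂ T X Y =
    T.map (T₂ T X Y) ≫ T₂ T (T.obj X) (T.obj Y) ≫ (T.μ.app X ⊗ₘ T.μ.app Y) :=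
  Bimonad.mul_tensor X Y

theorem μ_T₀ (T : Monad C) [Bimonad T] : T.μ.app (𝟙_ C) ≫ T₀ T = T.map (T₀ T) ≫ T₀ T :=
  Bimonad.mul_unit

theorem η_T₂ (T : Monad C) [Bimonad T] (X Y : C) :
    T.η.app (X ⊗ Y) ≫ T₂ T X Y = (T.η.app X ⊗ₘ T.η.app Y) :=
  Bimonad.unit_tensor X Y

theorem η_T₀ (T : Monad C) [Bimonad T] : T.η.app (𝟙_ C) ≫ T₀ T = 𝟙 (𝟙_ C) :=
  Bimonad.unit_unit

variable [Bimonad T]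

theorem tensor_act_hom {A A' B B' : C} {a : T.obj A ⟶ A} {a' : T.obj A' ⟶ A'}
    {b : T.obj B ⟶ B} {b' : T.obj B' ⟶ B'} {f : A ⟶ A'} {g : B ⟶ B'}
    (hf : T.map f ≫ a' = a ≫ f) (hg : T.map g ≫ b' = b ≫ g) :
    T.map (f ⊗ₘ g) ≫ T₂ T A' B' ≫ (a' ⊗ₘ b') = (T₂ T A B ≫ (a ⊗ₘ b)) ≫ (f ⊗ₘ g) := by
  rw [← Category.assoc, T₂_nat, Category.assoc, tensorHom_comp_tensorHom, hf, hg, Category.assoc,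
    tensorHom_comp_tensorHom]

theorem tensor_act_associator {X Y Z : C} (a : T.obj X ⟶ X) (b : T.obj Y ⟶ Y) (c : T.obj Z ⟶ Z) :
    T.map (α_ X Y Z).hom ≫ T₂ T X (Y ⊗ Z) ≫ (a ⊗ₘ T₂ T Y Z ≫ (b ⊗ₘ c)) =
      (T₂ T (X ⊗ Y) Z ≫ ((T₂ T X Y ≫ (a ⊗ₘ b)) ⊗ₘ c)) ≫ (α_ X Y Z).hom := by
  have h := T₂_assoc T X Y Z
  have e₁ : (a ⊗ₘ T₂ T Y Z ≫ (b ⊗ₘ c)) = T.obj X ◁ T₂ T Y Z ≫ (a ⊗ₘ (b ⊗ₘ c)) := by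
    rw [← id_tensorHom, tensorHom_comp_tensorHom, Category.id_comp]
  have e₂ : ((T₂ T X Y ≫ (a ⊗ₘ b)) ⊗ₘ c) = T₂ T X Y ▷ T.obj Z ≫ ((a ⊗ₘ b) ⊗ₘ c) := by
    rw [← tensorHom_id, tensorHom_comp_tensorHom, Category.id_comp]
  rw [e₁, e₂, Category.assoc, Category.assoc, associator_naturality]
  simp only [← Category.assoc] at h ⊢
  rw [h]

/-- The tensor product of two modules: the action on `M ⊗ N` is `(r ⊗ s) T₂`. -/
abbrev tensorModule (M N : T.Algebra) : T.Algebra where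
  A := M.A ⊗ N.A
  a := T₂ T M.A N.A ≫ (M.a ⊗ₘ N.a)
  unit := by
    have h : T.η.app (M.A ⊗ N.A) ≫ T₂ T M.A N.A = (T.η.app M.A ⊗ₘ T.η.app N.A) := η_T₂ T M.A N.A
    have h₁ := M.unit
    have h₂ := N.unit
    rw [← Category.assoc, h, tensorHom_comp_tensorHom]
    erw [h₁, h₂]
    exact id_tensorHom_id _ _
  assoc := by
    rw [← Category.assoc, μ_T₂, T.map_comp, Category.assoc, Category.assoc,
      tensorHom_comp_tensorHom, Category.assoc, ← Category.assoc (T.map (_ ⊗ₘ _)), T₂_nat,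
      Category.assoc, tensorHom_comp_tensorHom, M.assoc, N.assoc]

/-- The unit module, with action `T₀`. -/
abbrev unitModule : T.Algebra where
  A := 𝟙_ C
  a := T₀ T
  unit := η_T₀ T
  assoc := μ_T₀ T

omit [MonoidalCategory C] [Bimonad T] in
variable (T) in
theorem T_map_id_comp {X : C} (a : T.obj X ⟶ X) : T.map (𝟙 X) ≫ a = a ≫ 𝟙 X := by simp

instance : MonoidalCategoryStruct T.Algebra where
  tensorObj := tensorModule
  tensorUnit := unitModule
  whiskerLeft M _ _ f :=
    { f := M.A ◁ f.f
      h := by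
        rw [← id_tensorHom]
        exact tensor_act_hom (T_map_id_comp T M.a) f.h }
  whiskerRight f N :=
    { f := f.f ▷ N.A
      h := by
        rw [← tensorHom_id]
        exact tensor_act_hom f.h (T_map_id_comp T N.a) }
  tensorHom f g :=
    { f := f.f ⊗ₘ g.f
      h := tensor_act_hom f.h g.h }
  associator M N P := Monad.Algebra.isoMk (α_ M.A N.A P.A) (tensor_act_associator M.a N.a P.a)
  leftUnitor M := Monad.Algebra.isoMk (λ_ M.A) (by
    rw [T₂_left_unit, Category.assoc, Category.assoc, Category.assoc, ← leftUnitor_naturality,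
      MonoidalCategory.tensorHom_def, Category.assoc])
  rightUnitor M := Monad.Algebra.isoMk (ρ_ M.A) (by
    rw [T₂_right_unit, Category.assoc, Category.assoc, Category.assoc, ← rightUnitor_naturality,
      MonoidalCategory.tensorHom_def', Category.assoc])

/-- The monoidal category of modules over a bimonad; the forgetful functor is strictly monoidal. -/
instance : MonoidalCategory T.Algebra where
  tensorHom_def _ _ := Monad.Algebra.Hom.ext (MonoidalCategory.tensorHom_def _ _)
  id_tensorHom_id _ _ := Monad.Algebra.Hom.ext (id_tensorHom_id _ _)
  tensorHom_comp_tensorHom _ _ _ _ := Monad.Algebra.Hom.ext (tensorHom_comp_tensorHom _ _ _ _)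
  whiskerLeft_id _ _ := Monad.Algebra.Hom.ext (MonoidalCategory.whiskerLeft_id _ _)
  id_whiskerRight _ _ := Monad.Algebra.Hom.ext (id_whiskerRight _ _)
  associator_naturality _ _ _ := Monad.Algebra.Hom.ext (associator_naturality _ _ _)
  leftUnitor_naturality _ := Monad.Algebra.Hom.ext (leftUnitor_naturality _)
  rightUnitor_naturality _ := Monad.Algebra.Hom.ext (rightUnitor_naturality _)
  pentagon _ _ _ _ := Monad.Algebra.Hom.ext (pentagon _ _ _ _)
  triangle _ _ := Monad.Algebra.Hom.ext (triangle _ _)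

end Modules

/-! ### Duals of modules over a Hopf monad -/

section DualModules

variable {C : Type u} [Category.{v} C] [MonoidalCategory C]

/-- An action `t` of an oplax monoidal functor `K` on `A` which has a partner `r` on `∨A`
compatible with the coevaluation is cancellable: a morphism `K Z ⟶ ∨A` is determined by its
convolution with `t` along the evaluation. -/
theorem ext_lEv_conv [RightRigidCategory C] (K : C ⥤ C) [K.OplaxMonoidal] {Z A : C}
    {t : K.obj A ⟶ A} {r : K.obj (lDual A) ⟶ lDual A}
    (hc : K.map (lCoev A) ≫ Functor.OplaxMonoidal.δ K A (lDual A) ≫ (t ⊗ₘ r) =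
      Functor.OplaxMonoidal.η K ≫ lCoev A)
    {f g : K.obj Z ⟶ lDual A}
    (h : Functor.OplaxMonoidal.δ K Z A ≫ (f ⊗ₘ t) ≫ lEv A =
      Functor.OplaxMonoidal.δ K Z A ≫ (g ⊗ₘ t) ≫ lEv A) : f = g := by
  have key : ∀ f : K.obj Z ⟶ lDual A,
      f = K.map ((ρ_ Z).inv ≫ Z ◁ lCoev A ≫ (α_ _ _ _).inv) ≫
        Functor.OplaxMonoidal.δ K (Z ⊗ A) (lDual A) ≫
          ((Functor.OplaxMonoidal.δ K Z A ≫ (f ⊗ₘ t) ≫ lEv A) ⊗ₘ r) ≫ (λ_ _).hom := by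
    intro f
    have ha := Functor.OplaxMonoidal.oplax_associativity K Z A (lDual A)
    have ha' : Functor.OplaxMonoidal.δ K (Z ⊗ A) (lDual A) ≫
        Functor.OplaxMonoidal.δ K Z A ▷ K.obj (lDual A) =
        K.map (α_ Z A (lDual A)).hom ≫ Functor.OplaxMonoidal.δ K Z (A ⊗ lDual A) ≫
          K.obj Z ◁ Functor.OplaxMonoidal.δ K A (lDual A) ≫ (α_ _ _ _).inv := by
      rw [← cancel_mono (α_ _ _ _).hom]
      simp [ha]
    have hn := Functor.OplaxMonoidal.δ_natural_right K Z (lCoev A)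
    have hu := Functor.OplaxMonoidal.oplax_right_unitality K Z
    symm
    calc
      _ = K.map ((ρ_ Z).inv ≫ Z ◁ lCoev A ≫ (α_ _ _ _).inv) ≫
          (Functor.OplaxMonoidal.δ K (Z ⊗ A) (lDual A) ≫
            Functor.OplaxMonoidal.δ K Z A ▷ K.obj (lDual A)) ≫
            ((f ⊗ₘ t) ⊗ₘ r) ≫ lEv A ▷ _ ≫ (λ_ _).hom := by
        simp only [MonoidalCategory.tensorHom_def, comp_whiskerRight, Category.assoc,
          whisker_exchange_assoc]
      _ = K.map (ρ_ Z).inv ≫ (K.map (Z ◁ lCoev A) ≫ Functor.OplaxMonoidal.δ K Z (A ⊗ lDual A)) ≫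
          K.obj Z ◁ Functor.OplaxMonoidal.δ K A (lDual A) ≫ (α_ _ _ _).inv ≫
            ((f ⊗ₘ t) ⊗ₘ r) ≫ lEv A ▷ _ ≫ (λ_ _).hom := by
        rw [ha']
        simp only [Functor.map_comp, Category.assoc]
        rw [← K.map_comp_assoc (α_ _ _ _).inv, Iso.inv_hom_id, K.map_id, Category.id_comp]
      _ = K.map (ρ_ Z).inv ≫ Functor.OplaxMonoidal.δ K Z (𝟙_ C) ≫
          K.obj Z ◁ (K.map (lCoev A) ≫ Functor.OplaxMonoidal.δ K A (lDual A) ≫ (t ⊗ₘ r)) ≫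
            f ▷ _ ≫ (α_ _ _ _).inv ≫ lEv A ▷ _ ≫ (λ_ _).hom := by
        rw [← hn]
        simp only [MonoidalCategory.whiskerLeft_comp, Category.assoc]
        rw [← associator_inv_naturality_assoc, MonoidalCategory.tensorHom_def'_assoc f]
      _ = (K.map (ρ_ Z).inv ≫ Functor.OplaxMonoidal.δ K Z (𝟙_ C) ≫
          K.obj Z ◁ Functor.OplaxMonoidal.η K) ≫ (K.obj Z ◁ lCoev A ≫
            f ▷ _) ≫ (α_ _ _ _).inv ≫ lEv A ▷ _ ≫ (λ_ _).hom := by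
        rw [hc]
        simp only [MonoidalCategory.whiskerLeft_comp, Category.assoc]
      _ = f ⊗≫ (lDual A ◁ lCoev A ⊗≫ lEv A ▷ lDual A) ⊗≫ 𝟙 _ := by
        rw [← hu, whisker_exchange]
        monoidal
      _ = f := by rw [zigzag_right]; monoidal
  rw [key f, key g, h]

variable [RigidCategory C] {T : Monad C} [HopfMonad T]

/-- The action `sˡ_A T(∨r) : T(∨A) ⟶ ∨A` on the left dual of a module `(A, r)`. -/
def dualAct (M : T.Algebra) : T.obj (lDual M.A) ⟶ lDual M.A :=
  T.map (lMap M.a) ≫ sl T M.A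

/-- The evaluation is `T`-linear for the dual action. -/
theorem dualAct_lEv (M : T.Algebra) :
    T₂ T (lDual M.A) M.A ≫ (dualAct M ⊗ₘ M.a) ≫ lEv M.A = T.map (lEv M.A) ≫ T₀ T := by
  have h : T.map (lMap (T.η.app M.A) ▷ M.A) ≫ T.map (lEv M.A) ≫ T₀ T =
    T₂ T (lDual (T.obj M.A)) M.A ≫ (T.map (lMap (T.μ.app M.A)) ≫ sl T (T.obj M.A)) ▷ T.obj M.A ≫
        lEv (T.obj M.A) := (HopfMonad.leftAntipode (T := T)).ev M.A
  have h₁ : lMap M.a ≫ lMap (T.η.app M.A) = 𝟙 _ := by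
    rw [← lMap_id, ← M.unit, lMap_comp]
  have h₂ : T.map (lMap M.a) ≫ T.map (lMap (T.μ.app M.A)) ≫ sl T (T.obj M.A) =
      dualAct M ≫ lMap M.a := by
    rw [← Category.assoc, ← T.map_comp, ← lMap_comp, M.assoc, lMap_comp, T.map_comp,
      Category.assoc, sl_naturality, dualAct, Category.assoc]
  have h₃ : lMap M.a ▷ T.obj M.A ≫ lEv (T.obj M.A) = lDual M.A ◁ M.a ≫ lEv M.A := lMap_lEv _
  calc
    _ = T₂ T (lDual M.A) M.A ≫ (dualAct M ≫ lMap M.a) ▷ T.obj M.A ≫ lEv (T.obj M.A) := by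
      rw [comp_whiskerRight, Category.assoc, h₃, MonoidalCategory.tensorHom_def, Category.assoc]
    _ = T.map (lMap M.a ▷ M.A) ≫ T.map (lMap (T.η.app M.A) ▷ M.A) ≫ T.map (lEv M.A) ≫ T₀ T := by
      rw [h, ← h₂, comp_whiskerRight, Category.assoc, ← Category.assoc (T.map _), T₂_nat_left,
        Category.assoc]
    _ = _ := by
      rw [← T.map_comp_assoc, ← comp_whiskerRight, h₁, id_whiskerRight, T.map_id,
        Category.id_comp]

/-- The coevaluation is `T`-linear for the dual action. -/
theorem lCoev_dualAct (M : T.Algebra) :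
    T.map (lCoev M.A) ≫ T₂ T M.A (lDual M.A) ≫ (M.a ⊗ₘ dualAct M) = T₀ T ≫ lCoev M.A := by
  have h : T₀ T ≫ lCoev M.A ≫ T.η.app M.A ▷ lDual M.A =
      T.map (lCoev (T.obj M.A)) ≫ T₂ T (T.obj M.A) (lDual (T.obj M.A)) ≫
        (T.μ.app M.A ⊗ₘ sl T M.A) :=
    (HopfMonad.leftAntipode (T := T)).coev M.A
  have h₁ : lCoev M.A ≫ M.A ◁ lMap M.a = lCoev (T.obj M.A) ≫ M.a ▷ lDual (T.obj M.A) :=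
    lCoev_lMap M.a
  have h₂ : T.η.app M.A ≫ M.a = 𝟙 M.A := M.unit
  calc
    _ = T.map (lCoev M.A ≫ M.A ◁ lMap M.a) ≫ T₂ T M.A (lDual (T.obj M.A)) ≫
        (M.a ⊗ₘ sl T M.A) := by
      rw [T.map_comp, Category.assoc, ← Category.assoc (T.map (_ ◁ _)), T₂_nat_right,
        Category.assoc, ← id_tensorHom, tensorHom_comp_tensorHom, Category.id_comp, dualAct]
    _ = (T.map (lCoev (T.obj M.A)) ≫ T₂ T (T.obj M.A) (lDual (T.obj M.A)) ≫
        (T.μ.app M.A ⊗ₘ sl T M.A)) ≫ M.a ▷ lDual M.A := by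
      rw [h₁, T.map_comp, Category.assoc, ← Category.assoc (T.map (_ ▷ _)), T₂_nat_left,
        Category.assoc, ← tensorHom_id, tensorHom_comp_tensorHom, Category.id_comp, ← M.assoc,
        Category.assoc, Category.assoc, ← tensorHom_id, tensorHom_comp_tensorHom,
        Category.comp_id]
    _ = _ := by
      rw [← h, Category.assoc, Category.assoc, ← comp_whiskerRight, h₂]
      erw [id_whiskerRight, Category.comp_id]

/-- The left dual of a module. The unit and associativity of the dual action hold because the
module structure of `M` is its convolution inverse along the duality. -/
abbrev dualModule (M : T.Algebra) : T.Algebra where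
  A := lDual M.A
  a := dualAct M
  unit := by
    apply ext_lEv
    have h := dualAct_lEv M
    have h₁ : T.η.app (lDual M.A ⊗ M.A) ≫ T₂ T _ _ = _ := η_T₂ T (lDual M.A) M.A
    have h₂ : T.η.app M.A ≫ M.a = 𝟙 M.A := M.unit
    have h₃ : lEv M.A ≫ T.η.app (𝟙_ C) = T.η.app _ ≫ T.map (lEv M.A) := T.η.naturality _
    have h₄ := η_T₀ T
    change (T.η.app (lDual M.A) ≫ dualAct M) ▷ M.A ≫ lEv M.A = 𝟙 (lDual M.A) ▷ M.A ≫ lEv M.A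
    calc
      _ = (T.η.app (lDual M.A ⊗ M.A) ≫ T₂ T _ _) ≫ (dualAct M ⊗ₘ M.a) ≫ lEv M.A := by
        rw [h₁, tensorHom_comp_tensorHom_assoc, h₂]
        erw [tensorHom_id]
        rfl
      _ = _ := by
        rw [Category.assoc, h, ← Category.assoc, ← h₃, Category.assoc, h₄, id_whiskerRight,
          Category.comp_id, Category.id_comp]
  assoc := by
    let := Bimonad.oplax (T := T)
    have hev := dualAct_lEv M
    have hcoev := lCoev_dualAct M
    have e₁ : ∀ X Y, Functor.OplaxMonoidal.δ (T.toFunctor ⋙ T.toFunctor) X Y =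
      T.map (T₂ T X Y) ≫ T₂ T (T.obj X) (T.obj Y) := fun _ _ => rfl
    have e₂ : Functor.OplaxMonoidal.η (T.toFunctor ⋙ T.toFunctor) = T.map (T₀ T) ≫ T₀ T := rfl
    have hμ := μ_T₂ T (lDual M.A) M.A
    have hμ' := μ_T₂ T M.A (lDual M.A)
    have hμ₀ := μ_T₀ T
    have nat₁ : T.map (T.map (lEv M.A)) ≫ T.μ.app (𝟙_ C) = T.μ.app _ ≫ T.map (lEv M.A) :=
      T.μ.naturality _
    have nat₂ : T.map (T.map (lCoev M.A)) ≫ T.μ.app _ = T.μ.app _ ≫ T.map (lCoev M.A) :=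
      T.μ.naturality _
    have ha := M.assoc
    -- Both sides are convolution inverse to the action of `T²` on `M`.
    apply ext_lEv_conv (T.toFunctor ⋙ T.toFunctor) (t := T.μ.app M.A ≫ M.a)
      (r := T.μ.app _ ≫ dualAct M)
    · rw [e₁, e₂]
      change T.map (T.map (lCoev M.A)) ≫ (T.map (T₂ T M.A (lDual M.A)) ≫
        T₂ T (T.obj M.A) (T.obj (lDual M.A))) ≫
        (T.μ.app M.A ≫ M.a ⊗ₘ T.μ.app (lDual M.A) ≫ dualAct M) = _
      rw [← tensorHom_comp_tensorHom, Category.assoc, Category.assoc,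
        ← Category.assoc (T₂ T (T.obj M.A) _), ← Category.assoc (T.map (T₂ T _ _)), ← hμ',
        Category.assoc, ← Category.assoc, nat₂, Category.assoc, hcoev, ← Category.assoc, hμ₀,
        Category.assoc]
    · rw [e₁]
      change (T.map (T₂ T (lDual M.A) M.A) ≫ T₂ T (T.obj (lDual M.A)) (T.obj M.A)) ≫
        (T.μ.app (lDual M.A) ≫ dualAct M ⊗ₘ T.μ.app M.A ≫ M.a) ≫ lEv M.A =
        (T.map (T₂ T (lDual M.A) M.A) ≫ T₂ T (T.obj (lDual M.A)) (T.obj M.A)) ≫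
        (T.map (dualAct M) ≫ dualAct M ⊗ₘ T.μ.app M.A ≫ M.a) ≫ lEv M.A
      have hl : (T.map (T₂ T (lDual M.A) M.A) ≫ T₂ T (T.obj (lDual M.A)) (T.obj M.A)) ≫
          (T.μ.app (lDual M.A) ≫ dualAct M ⊗ₘ T.μ.app M.A ≫ M.a) ≫ lEv M.A =
          T.μ.app _ ≫ T.map (lEv M.A) ≫ T₀ T := by
        rw [← tensorHom_comp_tensorHom, Category.assoc, Category.assoc,
          ← Category.assoc (T₂ T (T.obj _) _), ← Category.assoc (T.map (T₂ T _ _)), ← hμ,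
          Category.assoc, hev]
      rw [hl, ha, ← tensorHom_comp_tensorHom, Category.assoc, Category.assoc,
        ← Category.assoc (T₂ T (T.obj _) _), ← T₂_nat, Category.assoc, hev,
        ← T.map_comp_assoc, ← T.map_comp_assoc, Category.assoc, hev, T.map_comp, Category.assoc,
        ← hμ₀, ← Category.assoc, ← nat₁, Category.assoc]

/-- The module category of a Hopf monad has left duals, preserved by the forgetful functor. -/
instance : RightRigidCategory T.Algebra where
  rightDual M :=
    { rightDual := dualModule M
      exact :=
        { coevaluation' := { f := lCoev M.A, h := lCoev_dualAct M }
          evaluation' :=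
            { f := lEv M.A, h := (dualAct_lEv M).symm.trans (Category.assoc _ _ _).symm }
          coevaluation_evaluation' :=
            Monad.Algebra.Hom.ext (lPairing M.A).coevaluation_evaluation'
          evaluation_coevaluation' :=
            Monad.Algebra.Hom.ext (lPairing M.A).evaluation_coevaluation' } }

end DualModules

/-! ### The braiding of modules defined by an R-matrix -/

section Braiding

variable {C : Type u} [Category.{v} C] [MonoidalCategory C] {T : Monad C} [Bimonad T]

/-- The braiding `(s ⊗ r) R : M ⊗ N ⟶ N ⊗ M` of two modules `(M, r)` and `(N, s)`. -/
def braidMap (R : RMatrix T) (M N : T.Algebra) : M.A ⊗ N.A ⟶ N.A ⊗ M.A :=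
  R.app M.A N.A ≫ (N.a ⊗ₘ M.a)

variable (R : RMatrix T)

theorem braidMap_naturality {M M' N N' : T.Algebra} (f : M ⟶ M') (g : N ⟶ N') :
    (f.f ⊗ₘ g.f) ≫ braidMap R M' N' = braidMap R M N ≫ (g.f ⊗ₘ f.f) := by
  rw [braidMap, braidMap, ← Category.assoc, R.naturality, Category.assoc, Category.assoc,
    tensorHom_comp_tensorHom, tensorHom_comp_tensorHom, f.h, g.h]

theorem braidMap_linear (M N : T.Algebra) :
    T.map (braidMap R M N) ≫ T₂ T N.A M.A ≫ (N.a ⊗ₘ M.a) =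
      (T₂ T M.A N.A ≫ (M.a ⊗ₘ N.a)) ≫ braidMap R M N := by
  have h := R.comm M.A N.A
  rw [braidMap, T.map_comp, Category.assoc, ← Category.assoc (T.map (_ ⊗ₘ _)), T₂_nat,
    Category.assoc, tensorHom_comp_tensorHom, ← M.assoc, ← N.assoc, ← tensorHom_comp_tensorHom,
    ← Category.assoc (T₂ T _ _), ← Category.assoc (T.map _), ← h, Category.assoc, Category.assoc,
    Category.assoc, tensorHom_comp_tensorHom, M.assoc, N.assoc, ← tensorHom_comp_tensorHom,
    ← Category.assoc (R.app _ _), ← R.naturality, Category.assoc]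

omit [MonoidalCategory C] [Bimonad T] in
theorem act_η (M : T.Algebra) : T.η.app M.A ≫ M.a = 𝟙 M.A := M.unit

omit [Bimonad T] in
theorem act_η_tensor (M N : T.Algebra) :
    (T.η.app M.A ⊗ₘ T.η.app N.A) ≫ (M.a ⊗ₘ N.a) = 𝟙 (M.A ⊗ N.A) := by
  rw [tensorHom_comp_tensorHom, act_η, act_η]
  exact id_tensorHom_id _ _

theorem exists_braidMap_inv : ∃ Q : ∀ M N : T.Algebra, N.A ⊗ M.A ⟶ M.A ⊗ N.A,
    ∀ M N, braidMap R M N ≫ Q M N = 𝟙 _ ∧ Q M N ≫ braidMap R M N = 𝟙 _ := by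
  obtain ⟨Q, hn, h₁, h₂⟩ := R.invertible
  refine ⟨fun M N => Q M.A N.A ≫ (M.a ⊗ₘ N.a), fun M N => ⟨?_, ?_⟩⟩
  · rw [braidMap, Category.assoc, ← Category.assoc (N.a ⊗ₘ M.a), hn, Category.assoc,
      tensorHom_comp_tensorHom, ← M.assoc, ← N.assoc, ← tensorHom_comp_tensorHom,
      ← Category.assoc (Q _ _), ← Category.assoc (R.app _ _), h₁, act_η_tensor]
  · rw [braidMap, Category.assoc, ← Category.assoc (M.a ⊗ₘ N.a), R.naturality, Category.assoc,
      tensorHom_comp_tensorHom, ← M.assoc, ← N.assoc, ← tensorHom_comp_tensorHom,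
      ← Category.assoc (R.app _ _), ← Category.assoc (Q _ _), h₂, act_η_tensor]

theorem isIso_braidMap (M N : T.Algebra) : IsIso (braidMap R M N) :=
  let ⟨Q, hQ⟩ := exists_braidMap_inv R
  ⟨Q M N, hQ M N⟩

theorem act_braidMap (M N : T.Algebra) : M.a ▷ N.A ≫ braidMap R M N =
    R.app (T.obj M.A) N.A ≫ T.obj N.A ◁ T.μ.app M.A ≫ (N.a ⊗ₘ M.a) := by
  have h := R.naturality M.a (𝟙 N.A)
  rw [tensorHom_id, T.map_id, id_tensorHom] at h
  rw [braidMap, ← Category.assoc, h, Category.assoc, ← id_tensorHom, tensorHom_comp_tensorHom,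
    ← M.assoc, ← id_tensorHom, tensorHom_comp_tensorHom]

theorem braidMap_act (M N : T.Algebra) : M.A ◁ N.a ≫ braidMap R M N =
    R.app M.A (T.obj N.A) ≫ T.μ.app N.A ▷ T.obj M.A ≫ (N.a ⊗ₘ M.a) := by
  have h := R.naturality (𝟙 M.A) N.a
  rw [id_tensorHom, T.map_id, tensorHom_id] at h
  rw [braidMap, ← Category.assoc, h, Category.assoc, ← tensorHom_id, tensorHom_comp_tensorHom,
    ← N.assoc, ← tensorHom_id, tensorHom_comp_tensorHom]

theorem braidMap_tensor_right (M N P : T.Algebra) :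
    (α_ M.A N.A P.A).hom ≫ braidMap R M (N ⊗ P) ≫ (α_ N.A P.A M.A).hom =
      braidMap R M N ▷ P.A ≫ (α_ N.A M.A P.A).hom ≫ N.A ◁ braidMap R M P := by
  have h := R.tensor_right M.A N.A P.A
  have h' := act_braidMap R M P
  have e : braidMap R M (N ⊗ P) =
    R.app M.A (N.A ⊗ P.A) ≫ ((T₂ T N.A P.A ≫ (N.a ⊗ₘ P.a)) ⊗ₘ M.a) := rfl
  calc
    _ = 𝟙 _ ⊗≫ (R.app M.A (N.A ⊗ P.A) ≫ T₂ T N.A P.A ▷ T.obj M.A) ⊗≫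
        ((N.a ⊗ₘ P.a) ⊗ₘ M.a) ⊗≫ 𝟙 _ := by
      rw [e]; simp only [MonoidalCategory.tensorHom_def]; monoidal
    _ = R.app M.A N.A ▷ P.A ⊗≫ T.obj N.A ◁ (R.app (T.obj M.A) P.A ≫
        T.obj P.A ◁ T.μ.app M.A ≫ (P.a ⊗ₘ M.a)) ⊗≫ N.a ▷ (P.A ⊗ M.A) := by
      rw [h]; simp only [MonoidalCategory.tensorHom_def']; monoidal
    _ = R.app M.A N.A ▷ P.A ⊗≫ T.obj N.A ◁ M.a ▷ P.A ⊗≫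
        (T.obj N.A ◁ braidMap R M P ≫ N.a ▷ (P.A ⊗ M.A)) := by
      rw [← h']; monoidal
    _ = _ := by
      rw [whisker_exchange]
      conv_rhs => rw [braidMap, MonoidalCategory.tensorHom_def']
      monoidal

theorem braidMap_tensor_left (M N P : T.Algebra) :
    (α_ M.A N.A P.A).inv ≫ braidMap R (M ⊗ N) P ≫ (α_ P.A M.A N.A).inv =
      M.A ◁ braidMap R N P ≫ (α_ M.A P.A N.A).inv ≫ braidMap R M P ▷ N.A := by
  have h := R.tensor_left M.A N.A P.A
  have h' := braidMap_act R M P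
  have e : braidMap R (M ⊗ N) P =
    R.app (M.A ⊗ N.A) P.A ≫ (P.a ⊗ₘ (T₂ T M.A N.A ≫ (M.a ⊗ₘ N.a))) := rfl
  calc
    _ = 𝟙 _ ⊗≫ (R.app (M.A ⊗ N.A) P.A ≫ T.obj P.A ◁ T₂ T M.A N.A) ⊗≫
        (P.a ⊗ₘ (M.a ⊗ₘ N.a)) ⊗≫ 𝟙 _ := by
      rw [e]; simp only [MonoidalCategory.tensorHom_def']; monoidal
    _ = M.A ◁ R.app N.A P.A ⊗≫ (R.app M.A (T.obj P.A) ≫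
        T.μ.app P.A ▷ T.obj M.A ≫ (P.a ⊗ₘ M.a)) ▷ T.obj N.A ⊗≫ (P.A ⊗ M.A) ◁ N.a := by
      rw [h]; simp only [MonoidalCategory.tensorHom_def]; monoidal
    _ = M.A ◁ R.app N.A P.A ⊗≫ M.A ◁ P.a ▷ T.obj N.A ⊗≫
        (braidMap R M P ▷ T.obj N.A ≫ (P.A ⊗ M.A) ◁ N.a) := by
      rw [← h']; monoidal
    _ = _ := by
      rw [← whisker_exchange]
      conv_rhs => rw [braidMap, MonoidalCategory.tensorHom_def]
      monoidal

/-- An R-matrix makes the monoidal category of modules braided. -/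
@[reducible]
def braidedModules : BraidedCategory T.Algebra where
  braiding M N :=
    Monad.Algebra.isoMk (@asIso _ _ _ _ (braidMap R M N) (isIso_braidMap R M N))
      (braidMap_linear R M N)
  braiding_naturality_right M N P f := Monad.Algebra.Hom.ext (by
    have h := braidMap_naturality R (𝟙 M) f
    rw [Monad.Algebra.id_f, id_tensorHom, tensorHom_id] at h
    exact h)
  braiding_naturality_left f P := Monad.Algebra.Hom.ext (by
    have h := braidMap_naturality R f (𝟙 P)
    rw [Monad.Algebra.id_f, id_tensorHom, tensorHom_id] at h
    exact h)
  hexagon_forward M N P := Monad.Algebra.Hom.ext (braidMap_tensor_right R M N P)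
  hexagon_reverse M N P := Monad.Algebra.Hom.ext (braidMap_tensor_left R M N P)

end Braiding

/-! ### Elements of `Hom(1, T)` as endomorphisms of the forgetful functor -/

section Action

variable {C : Type u} [Category.{v} C] {T : Monad C}

/-- The action of `a ∈ Hom(1, T)` on a module `(A, r)`: the morphism `r a_A : A ⟶ A`. -/
def act (a : HomUnit T) (M : T.Algebra) : M.A ⟶ M.A := a.app M.A ≫ M.a

theorem act_naturality (a : HomUnit T) {M N : T.Algebra} (f : M ⟶ N) :
    f.f ≫ act a N = act a M ≫ f.f := by
  rw [act, act, Category.assoc, ← f.h, ← Category.assoc, ← Category.assoc]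
  exact congrArg (· ≫ N.a) (HomUnit.nat a f.f)

theorem act_mul (a b : HomUnit T) (M : T.Algebra) : act (a * b) M = act b M ≫ act a M := by
  have h : M.a ≫ a.app M.A = a.app (T.obj M.A) ≫ T.map M.a := HomUnit.nat a M.a
  rw [act, act, act, HomUnit.mul_app, Category.assoc, Category.assoc, Category.assoc, M.assoc,
    ← Category.assoc M.a, h, Category.assoc]

theorem act_one (M : T.Algebra) : act (1 : HomUnit T) M = 𝟙 M.A := M.unit

variable (T) in
/-- The free module on `X`. -/
abbrev freeModule (X : C) : T.Algebra where
  A := T.obj X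
  a := T.μ.app X
  unit := T.left_unit X
  assoc := (T.assoc X).symm

theorem η_act_free (a : HomUnit T) (X : C) : T.η.app X ≫ act a (freeModule T X) = a.app X :=
  congrArg (fun b : HomUnit T => b.app X) (mul_one a)

theorem HomUnit.ext_act {a b : HomUnit T} (h : ∀ M, act a M = act b M) : a = b := by
  ext X
  rw [← η_act_free a, ← η_act_free b, h]

/-- The structure map of a module as a morphism from the free module. -/
def actHom (M : T.Algebra) : freeModule T M.A ⟶ M where
  f := M.a
  h := M.assoc.symm

variable (T) in
/-- The morphism of free modules defined by a morphism of `C`. -/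
def freeMap {X Y : C} (f : X ⟶ Y) : freeModule T X ⟶ freeModule T Y where
  f := T.map f
  h := T.μ.naturality f

/-- The element of `Hom(1, T)` that acts on modules by a given endomorphism of the forgetful
functor. -/
def HomUnit.ofForget (f : T.forget ⟶ T.forget) : HomUnit T :=
  HomUnit.ofApp (fun X => T.η.app X ≫ f.app (freeModule T X)) fun {X Y} g => by
    have h₁ : T.map g ≫ f.app (freeModule T Y) = f.app (freeModule T X) ≫ T.map g :=
      f.naturality (freeMap T g)
    have h₂ : g ≫ T.η.app Y = T.η.app X ≫ T.map g := T.η.naturality g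
    have h₃ := congrArg (· ≫ f.app (freeModule T Y)) h₂
    have h₄ := congrArg (T.η.app X ≫ ·) h₁
    exact (Category.assoc _ _ _).symm.trans (h₃.trans ((Category.assoc _ _ _).trans
      (h₄.trans (Category.assoc _ _ _).symm)))

theorem act_ofForget (f : T.forget ⟶ T.forget) (M : T.Algebra) :
    act (HomUnit.ofForget f) M = f.app M := by
  have h : M.a ≫ f.app M = f.app (freeModule T M.A) ≫ M.a := (f.naturality (actHom M))
  have h' : T.η.app M.A ≫ M.a = 𝟙 M.A := M.unit
  change (T.η.app M.A ≫ f.app (freeModule T M.A)) ≫ M.a = _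
  have h₁ := congrArg (T.η.app M.A ≫ ·) h
  have h₂ := congrArg (· ≫ f.app M) h'
  exact (Category.assoc _ _ _).trans (h₁.symm.trans ((Category.assoc _ _ _).symm.trans
    (h₂.trans (Category.id_comp _))))

theorem isUnit_of_isIso_act (a : HomUnit T) (h : ∀ M, IsIso (act a M)) : IsUnit a := by
  have := h
  let f : T.forget ⟶ T.forget :=
    { app := fun M => (inv (act a M) : M.A ⟶ M.A)
      naturality := fun M N g => by
        change g.f ≫ inv (act a N) = inv (act a M) ≫ g.f
        have := h N
        rw [IsIso.comp_inv_eq, Category.assoc, act_naturality, IsIso.inv_hom_id_assoc] }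
  have hf : ∀ M, act (HomUnit.ofForget f) M = inv (act a M) := act_ofForget f
  refine ⟨⟨a, HomUnit.ofForget f, ?_, ?_⟩, rfl⟩ <;> refine HomUnit.ext_act fun M => ?_
  · rw [act_mul, act_one, hf, IsIso.inv_hom_id]
  · rw [act_mul, act_one, hf, IsIso.hom_inv_id]

theorem isIso_act {a : HomUnit T} (h : IsUnit a) (M : T.Algebra) : IsIso (act a M) := by
  obtain ⟨u, rfl⟩ := h
  exact ⟨act (↑u⁻¹ : HomUnit T) M, by rw [← act_mul, Units.inv_mul, act_one],
    by rw [← act_mul, Units.mul_inv, act_one]⟩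

theorem IsCentral.act_linear {a : HomUnit T} (ha : IsCentral a) (M : T.Algebra) :
    T.map (act a M) ≫ M.a = M.a ≫ act a M := by
  have h : a.app (T.obj M.A) ≫ T.μ.app M.A = T.map (a.app M.A) ≫ T.μ.app M.A :=
    congrArg (fun t : T.toFunctor ⟶ T.toFunctor => t.app M.A) ha
  have hn : M.a ≫ act a M = act a (freeModule T M.A) ≫ M.a := act_naturality a (actHom M)
  have h' : act a (freeModule T M.A) = T.map (a.app M.A) ≫ T.μ.app M.A := h
  rw [hn, h', Category.assoc, M.assoc, act, T.map_comp, Category.assoc]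

/-- The action of a central element is a morphism of modules. -/
def IsCentral.actHom {a : HomUnit T} (ha : IsCentral a) (M : T.Algebra) : M ⟶ M where
  f := act a M
  h := ha.act_linear M

theorem Lact_mul (a b : HomUnit T) : Lact (a * b) = Lact b ≫ Lact a := by
  ext X
  exact act_mul a b (freeModule T X)

theorem Lact_one : Lact (1 : HomUnit T) = 𝟙 _ := by
  ext X
  exact act_one (freeModule T X)

theorem Ract_mul (a b : HomUnit T) : Ract (a * b) = Ract a ≫ Ract b := by
  ext X
  have h₁ : T.μ.app X ≫ T.map (b.app X) = T.map (T.map (b.app X)) ≫ T.μ.app (T.obj X) :=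
    (T.μ.naturality (b.app X)).symm
  have h₂ : b.app X ≫ a.app (T.obj X) = a.app X ≫ T.map (b.app X) := HomUnit.nat a (b.app X)
  have h₃ := T.assoc X
  change T.map (b.app X ≫ a.app (T.obj X) ≫ T.μ.app X) ≫ T.μ.app X =
    (T.map (a.app X) ≫ T.μ.app X) ≫ T.map (b.app X) ≫ T.μ.app X
  rw [← Category.assoc (b.app X), h₂]
  simp only [Functor.map_comp, Category.assoc]
  rw [h₃, ← Category.assoc (T.μ.app X), h₁, Category.assoc]

theorem Ract_one : Ract (1 : HomUnit T) = 𝟙 _ := by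
  ext X
  exact T.right_unit X

theorem Lact_Ract_comm (a b : HomUnit T) : Lact a ≫ Ract b = Ract b ≫ Lact a := by
  ext X
  let f : freeModule T X ⟶ freeModule T X := freeMap T (b.app X) ≫ actHom (freeModule T X)
  exact (act_naturality a f).symm

theorem comp_Lact_inj (a : (HomUnit T)ˣ) {f g : T.toFunctor ⟶ T.toFunctor} :
    f ≫ Lact (a : HomUnit T) = g ≫ Lact (a : HomUnit T) ↔ f = g := by
  refine ⟨fun h => ?_, fun h => by rw [h]⟩
  have := congrArg (· ≫ Lact (↑a⁻¹ : HomUnit T)) h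
  simpa only [Category.assoc, ← Lact_mul, Units.inv_mul, Lact_one, Category.comp_id] using this

/-- The condition `f = ad_a` without inverses: `R_a f = L_a`. -/
theorem eq_ad_iff (a : (HomUnit T)ˣ) (f : T.toFunctor ⟶ T.toFunctor) :
    f = ad a ↔ f ≫ Ract (a : HomUnit T) = Lact (a : HomUnit T) := by
  rw [ad, ← Lact_Ract_comm]
  constructor
  · rintro rfl
    rw [Category.assoc, ← Ract_mul, Units.inv_mul, Ract_one, Category.comp_id]
  · intro h
    rw [← h, Category.assoc, ← Ract_mul, Units.mul_inv, Ract_one, Category.comp_id]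

/-- If `R_a f = L_a`, then the same holds with `a * b` in place of `a` exactly when `b` is
central. -/
theorem comp_Ract_mul_iff (a : (HomUnit T)ˣ) (b : HomUnit T) (f : T.toFunctor ⟶ T.toFunctor)
    (h : f ≫ Ract (a : HomUnit T) = Lact (a : HomUnit T)) :
    f ≫ Ract ((a : HomUnit T) * b) = Lact ((a : HomUnit T) * b) ↔ IsCentral b := by
  rw [Ract_mul, Lact_mul, ← Category.assoc, h, IsCentral, Lact_Ract_comm, comp_Lact_inj,
    eq_comm]

end Action

section Tensor

variable {C : Type u} [Category.{v} C] [MonoidalCategory C] {T : Monad C} [Bimonad T]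

/-- An equation for the coproduct `T₂ g_{X ⊗ Y}` amounts to an equation for the action of `g` on
tensor products of modules. -/
theorem tensor_iff_act (g : HomUnit T) (h : ∀ M N : T.Algebra, M.A ⊗ N.A ⟶ M.A ⊗ N.A)
    (hn : ∀ {M M' N N' : T.Algebra} (f : M ⟶ M') (k : N ⟶ N'),
      (f.f ⊗ₘ k.f) ≫ h M' N' = h M N ≫ (f.f ⊗ₘ k.f)) :
    (∀ X Y : C, g.app (X ⊗ Y) ≫ T₂ T X Y =
      (T.η.app X ⊗ₘ T.η.app Y) ≫ h (freeModule T X) (freeModule T Y)) ↔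
    ∀ M N : T.Algebra, act g (M ⊗ N) = h M N := by
  constructor
  · intro H M N
    have h₁ : g.app (M.A ⊗ N.A) ≫ T₂ T M.A N.A = _ := H M.A N.A
    have h₂ : (M.a ⊗ₘ N.a) ≫ h M N = h (freeModule T M.A) (freeModule T N.A) ≫ (M.a ⊗ₘ N.a) :=
      hn (actHom M) (actHom N)
    have h₃ := act_η_tensor M N
    change g.app (M.A ⊗ N.A) ≫ T₂ T M.A N.A ≫ (M.a ⊗ₘ N.a) = _
    rw [← Category.assoc, h₁, Category.assoc]
    rw [← h₂, ← Category.assoc]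
    erw [h₃, Category.id_comp]
  · intro H X Y
    have h₁ : (T.η.app X ⊗ₘ T.η.app Y) ≫ g.app (T.obj X ⊗ T.obj Y) =
      g.app (X ⊗ Y) ≫ T.map (T.η.app X ⊗ₘ T.η.app Y) := HomUnit.nat g _
    have h₂ : T.map (T.η.app X ⊗ₘ T.η.app Y) ≫ T₂ T (T.obj X) (T.obj Y) = _ := T₂_nat T _ _
    have h₃ := T.right_unit X
    have h₄ := T.right_unit Y
    rw [← H]
    change _ = (T.η.app X ⊗ₘ T.η.app Y) ≫ g.app (T.obj X ⊗ T.obj Y) ≫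
      T₂ T (T.obj X) (T.obj Y) ≫ (T.μ.app X ⊗ₘ T.μ.app Y)
    rw [← Category.assoc, h₁, Category.assoc, ← Category.assoc (T.map _), h₂, Category.assoc]
    erw [tensorHom_comp_tensorHom, h₃, h₄]
    erw [id_tensorHom_id, Category.comp_id]
    rfl

omit [Bimonad T] in
theorem η_tensor_act (a b : HomUnit T) (X Y : C) :
    (T.η.app X ⊗ₘ T.η.app Y) ≫ (act a (freeModule T X) ⊗ₘ act b (freeModule T Y)) =
      (a.app X ⊗ₘ b.app Y) := by
  have h₁ := η_act_free a X
  have h₂ := η_act_free b Y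
  rw [← h₁, ← h₂]
  exact tensorHom_comp_tensorHom _ _ _ _

theorem grouplike_tensor_iff (g : HomUnit T) :
    (∀ X Y : C, g.app (X ⊗ Y) ≫ T₂ T X Y = (g.app X ⊗ₘ g.app Y)) ↔
      ∀ M N : T.Algebra, act g (M ⊗ N) = (act g M ⊗ₘ act g N) := by
  rw [← tensor_iff_act g (fun M N => (act g M ⊗ₘ act g N))]
  · simp only [η_tensor_act]
  · intro M M' N N' f k
    rw [tensorHom_comp_tensorHom, tensorHom_comp_tensorHom, act_naturality, act_naturality]

theorem twist_tensor_iff (R : RMatrix T) (θ : HomUnit T) :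
    (∀ X Y : C, θ.app (X ⊗ Y) ≫ T₂ T X Y =
      R.app X Y ≫ R.app (T.obj Y) (T.obj X) ≫
        ((T.μ.app X ≫ θ.app (T.obj X) ≫ T.μ.app X) ⊗ₘ
          (T.μ.app Y ≫ θ.app (T.obj Y) ≫ T.μ.app Y))) ↔
      ∀ M N : T.Algebra, act θ (M ⊗ N) =
        braidMap R M N ≫ braidMap R N M ≫ (act θ M ⊗ₘ act θ N) := by
  rw [← tensor_iff_act θ (fun M N => braidMap R M N ≫ braidMap R N M ≫ (act θ M ⊗ₘ act θ N))]
  · refine forall₂_congr fun X Y => ?_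
    have h₁ : (T.η.app X ⊗ₘ T.η.app Y) ≫ R.app (T.obj X) (T.obj Y) =
        R.app X Y ≫ (T.map (T.η.app Y) ⊗ₘ T.map (T.η.app X)) := R.naturality _ _
    have h₂ : (T.map (T.η.app Y) ⊗ₘ T.map (T.η.app X)) ≫ (T.μ.app Y ⊗ₘ T.μ.app X) =
        𝟙 (T.obj Y ⊗ T.obj X) := by
      have h₃ := T.right_unit X
      have h₄ := T.right_unit Y
      rw [tensorHom_comp_tensorHom, h₃, h₄]
      exact id_tensorHom_id _ _
    have h₃ : (T.η.app X ⊗ₘ T.η.app Y) ≫ braidMap R (freeModule T X) (freeModule T Y) =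
        R.app X Y := by
      change (T.η.app X ⊗ₘ T.η.app Y) ≫ R.app (T.obj X) (T.obj Y) ≫
        (T.μ.app Y ⊗ₘ T.μ.app X) = R.app X Y
      rw [← Category.assoc]
      erw [h₁]
      rw [Category.assoc]
      erw [h₂, Category.comp_id]
    have h₄ : (T.η.app X ⊗ₘ T.η.app Y) ≫ braidMap R (freeModule T X) (freeModule T Y) ≫
        braidMap R (freeModule T Y) (freeModule T X) ≫
          (act θ (freeModule T X) ⊗ₘ act θ (freeModule T Y)) =
        R.app X Y ≫ R.app (T.obj Y) (T.obj X) ≫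
        ((T.μ.app X ≫ θ.app (T.obj X) ≫ T.μ.app X) ⊗ₘ
          (T.μ.app Y ≫ θ.app (T.obj Y) ≫ T.μ.app Y)) := by
      rw [← Category.assoc]
      erw [h₃]
      rw [braidMap, Category.assoc, tensorHom_comp_tensorHom]
      rfl
    rw [← h₄]
  · intro M M' N N' f k
    rw [← Category.assoc, braidMap_naturality, Category.assoc, ← Category.assoc (k.f ⊗ₘ f.f),
      braidMap_naturality]
    simp only [Category.assoc]
    rw [tensorHom_comp_tensorHom, tensorHom_comp_tensorHom, act_naturality, act_naturality]

/-- An automorphism of the unit object that equals its own square is the identity. -/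
theorem eq_id_of_tensorHom_self {e : 𝟙_ C ⟶ 𝟙_ C} [IsIso e]
    (h : (λ_ (𝟙_ C)).hom ≫ e = (e ⊗ₘ e) ≫ (λ_ (𝟙_ C)).hom) : e = 𝟙 (𝟙_ C) := by
  rw [MonoidalCategory.tensorHom_def, Category.assoc, leftUnitor_naturality, ← Category.assoc,
    cancel_mono, unitors_equal, rightUnitor_naturality] at h
  rw [← cancel_epi (ρ_ (𝟙_ C)).hom, ← h, Category.comp_id]

/-- For an invertible element, compatibility with the counit follows from compatibility with the
coproduct. -/
theorem isGrouplike_of_tensor {g : HomUnit T} (hg : IsUnit g)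
    (h : ∀ X Y : C, g.app (X ⊗ Y) ≫ T₂ T X Y = (g.app X ⊗ₘ g.app Y)) : IsGrouplike g where
  tensor := h
  unit := by
    have h₁ := (grouplike_tensor_iff g).1 h (𝟙_ _) (𝟙_ _)
    have h₂ := act_naturality g (λ_ (𝟙_ T.Algebra)).hom
    have h₃ := isIso_act hg (𝟙_ T.Algebra)
    rw [h₁] at h₂
    change act g (𝟙_ T.Algebra) = 𝟙 (𝟙_ C)
    change (λ_ (𝟙_ C)).hom ≫ act g (𝟙_ T.Algebra) =
      (act g (𝟙_ T.Algebra) ⊗ₘ act g (𝟙_ T.Algebra)) ≫ (λ_ (𝟙_ C)).hom at h₂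
    exact @eq_id_of_tensorHom_self C _ _ _ h₃ h₂

end Tensor

/-! ### The Drinfeld element -/

section DrinfeldElement

variable {C : Type u} [Category.{v} C] [MonoidalCategory C] [RigidCategory C]
  {T : Monad C} [HopfMonad T]

/-- `S(f)` acts on a module as the transpose of the action of `f` on the dual module. -/
theorem lMap_act_S (f : HomUnit T) (M : T.Algebra) :
    lMap (act (S f) M) = act f (lDual M) := by
  have h : lMap M.a ≫ f.app (lDual (T.obj M.A)) = f.app (lDual M.A) ≫ T.map (lMap M.a) :=
    HomUnit.nat f (lMap M.a)
  have h₁ : lMap (act (S f) M) = lMap M.a ≫ lMap ((S f).app M.A) := lMap_comp _ _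
  change _ = f.app (lDual M.A) ≫ T.map (lMap M.a) ≫ sl T M.A
  rw [h₁, lMap_S_app, ← Category.assoc, h, Category.assoc]

theorem S_mul (f g : HomUnit T) : S (f * g) = S g * S f := by
  refine HomUnit.ext_act fun M => lMap_injective ?_
  rw [lMap_act_S, act_mul, act_mul, lMap_comp, lMap_act_S, lMap_act_S]
  rfl

/-- The underlying morphism of the Drinfeld isomorphism `M ≅ ∨∨M` of the braided category of
modules. -/
def drinfeldMap (R : RMatrix T) (M : T.Algebra) : M.A ⟶ lDual (lDual M.A) :=
  letI := braidedModules R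
  (drinfeldIso M).hom.f

variable (R : RMatrix T)

theorem drinfeldMap_naturality {M N : T.Algebra} (f : M ⟶ N) :
    f.f ≫ drinfeldMap R N = drinfeldMap R M ≫ lMap (lMap f.f) :=
  letI := braidedModules R
  congrArg Monad.Algebra.Hom.f (drinfeldIso_naturality f)

theorem drinfeldMap_linear (M : T.Algebra) :
    T.map (drinfeldMap R M) ≫ dualAct (dualModule M) = M.a ≫ drinfeldMap R M :=
  letI := braidedModules R
  (drinfeldIso M).hom.h

theorem isIso_drinfeldMap (M : T.Algebra) : IsIso (drinfeldMap R M) :=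
  letI := braidedModules R
  inferInstanceAs (IsIso (T.forget.map (drinfeldIso M).hom))

theorem drinfeldMap_tensor (M N : T.Algebra) :
    braidMap R M N ≫ braidMap R N M ≫ drinfeldMap R (M ⊗ N) =
      (drinfeldMap R M ⊗ₘ drinfeldMap R N) ≫ llDualTensor M.A N.A :=
  letI := braidedModules R
  congrArg Monad.Algebra.Hom.f (drinfeldIso_tensor M N)

/-- The evaluation of the module `M` against its dual through the braiding. -/
def moduleBraidedEv (M : T.Algebra) : M.A ⊗ lDual M.A ⟶ 𝟙_ C :=
  braidMap R M (dualModule M) ≫ lEv M.A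

theorem drinfeldMap_eq (M : T.Algebra) :
    drinfeldMap R M = (ρ_ M.A).inv ≫ M.A ◁ lCoev (lDual M.A) ≫ (α_ _ _ _).inv ≫
      moduleBraidedEv R M ▷ lDual (lDual M.A) ≫ (λ_ _).hom :=
  letI := braidedModules R
  congrArg Monad.Algebra.Hom.f (drinfeldIso_eq M)

/-- On free modules the braided evaluation restricts, along the unit of `T`, to the pairing in the
definition of the Drinfeld element. -/
theorem η_moduleBraidedEv (X : C) :
    (T.η.app X : X ⟶ T.obj X) ▷ lDual (T.obj X) ≫ moduleBraidedEv R (freeModule T X) =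
      X ◁ lMap (T.μ.app X : T.obj (T.obj X) ⟶ T.obj X) ≫ drinfeldPairing R X := by
  have key : ∀ (e : X ⟶ T.obj X) (m : T.obj (T.obj X) ⟶ T.obj X), T.map e ≫ m = 𝟙 (T.obj X) →
      e ▷ lDual (T.obj X) ≫ (R.app (T.obj X) (lDual (T.obj X)) ≫
        ((T.map (lMap m) ≫ sl T (T.obj X)) ⊗ₘ m)) ≫ lEv (T.obj X) =
      X ◁ lMap m ≫ drinfeldPairing R X := by
    intro e m h₃
    have h₁ := R.naturality e (𝟙 (lDual (T.obj X)))
    have h₂ := R.naturality (𝟙 X) (lMap m)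
    rw [T.map_id, tensorHom_id, id_tensorHom] at h₁
    rw [T.map_id, tensorHom_id, id_tensorHom] at h₂
    rw [drinfeldPairing, ← Category.assoc (X ◁ _), h₂, Category.assoc, Category.assoc,
      ← Category.assoc (_ ▷ _), h₁, Category.assoc, ← id_tensorHom,
      tensorHom_comp_tensorHom_assoc, Category.id_comp, ← comp_whiskerRight_assoc, h₃, tensorHom_id]
  exact key (T.η.app X) (T.μ.app X) (T.right_unit X)

variable (φ : SovereignStructure C)

/-- The Drinfeld isomorphism composed with the inverse of the sovereign structure, as an
endomorphism of the forgetful functor. -/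
def drinfeldForget : T.forget ⟶ T.forget where
  app M := (drinfeldMap R M ≫ inv (φ.app M.A) : M.A ⟶ M.A)
  naturality M N f := by
    change f.f ≫ drinfeldMap R N ≫ inv (φ.app N.A) = (drinfeldMap R M ≫ inv (φ.app M.A)) ≫ f.f
    rw [← Category.assoc, drinfeldMap_naturality, Category.assoc, φ.inv_naturality,
      Category.assoc]

/-- The Drinfeld element acts on modules by the Drinfeld isomorphism followed by `φ⁻¹`. -/
theorem drinfeld_eq_ofForget : drinfeld φ R = HomUnit.ofForget (drinfeldForget R φ) := by
  ext X
  have key : ∀ (e : X ⟶ T.obj X) (m : T.obj (T.obj X) ⟶ T.obj X)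
      (b : T.obj X ⊗ lDual (T.obj X) ⟶ 𝟙_ C) (d : X ⊗ lDual (T.obj (T.obj X)) ⟶ 𝟙_ C)
      (p : lDual (lDual (T.obj X)) ⟶ T.obj X)
      (q : lDual (lDual (T.obj (T.obj X))) ⟶ T.obj (T.obj X)),
      e ▷ lDual (T.obj X) ≫ b = X ◁ lMap m ≫ d → lMap (lMap m) ≫ p = q ≫ m →
      (ρ_ X).inv ≫ X ◁ lCoev (lDual (T.obj (T.obj X))) ≫ (α_ _ _ _).inv ≫
        (d ⊗ₘ (q ≫ m)) ≫ (λ_ (T.obj X)).hom =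
      e ≫ ((ρ_ (T.obj X)).inv ≫ T.obj X ◁ lCoev (lDual (T.obj X)) ≫ (α_ _ _ _).inv ≫
        b ▷ lDual (lDual (T.obj X)) ≫ (λ_ _).hom) ≫ p := by
    intro e m b d p q h₁ h₃
    have h₂ := lCoev_lMap (lMap m)
    rw [← h₃]
    symm
    calc
      _ = 𝟙 _ ⊗≫ (e ▷ 𝟙_ C ≫ T.obj X ◁ lCoev (lDual (T.obj X))) ⊗≫
          b ▷ lDual (lDual (T.obj X)) ⊗≫ p := by monoidal
      _ = 𝟙 _ ⊗≫ X ◁ lCoev (lDual (T.obj X)) ⊗≫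
          (e ▷ lDual (T.obj X) ≫ b) ▷ lDual (lDual (T.obj X)) ⊗≫ p := by
        rw [← whisker_exchange]; monoidal
      _ = 𝟙 _ ⊗≫ X ◁ (lCoev (lDual (T.obj X)) ≫ lMap m ▷ lDual (lDual (T.obj X))) ⊗≫
          d ▷ lDual (lDual (T.obj X)) ⊗≫ p := by
        rw [h₁]; monoidal
      _ = 𝟙 _ ⊗≫ X ◁ lCoev (lDual (T.obj (T.obj X))) ⊗≫
          ((X ⊗ lDual (T.obj (T.obj X))) ◁ lMap (lMap m) ≫
            d ▷ lDual (lDual (T.obj X))) ⊗≫ p := by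
        rw [← h₂]; monoidal
      _ = _ := by
        rw [whisker_exchange, MonoidalCategory.tensorHom_def]; monoidal
  have h := key (T.η.app X) (T.μ.app X) _ _ _ _ (η_moduleBraidedEv R X)
    (φ.inv_naturality (T.μ.app X : T.obj (T.obj X) ⟶ T.obj X))
  erw [← drinfeldMap_eq R (freeModule T X)] at h
  exact h

theorem act_drinfeld (M : T.Algebra) :
    act (drinfeld φ R) M = drinfeldMap R M ≫ inv (φ.app M.A) := by
  rw [drinfeld_eq_ofForget]
  exact act_ofForget _ M

theorem act_drinfeld_app (M : T.Algebra) :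
    act (drinfeld φ R) M ≫ φ.app M.A = drinfeldMap R M := by
  rw [act_drinfeld, Category.assoc, IsIso.inv_hom_id, Category.comp_id]

theorem isUnit_drinfeld : IsUnit (drinfeld φ R) :=
  isUnit_of_isIso_act _ fun M => by
    have := isIso_drinfeldMap R M
    rw [act_drinfeld]
    infer_instance

/-- The coproduct of the Drinfeld element, in terms of its action on tensor products of modules. -/
theorem act_drinfeld_tensor (M N : T.Algebra) :
    braidMap R M N ≫ braidMap R N M ≫ act (drinfeld φ R) (M ⊗ N) =
      (act (drinfeld φ R) M ⊗ₘ act (drinfeld φ R) N) := by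
  have h := drinfeldMap_tensor R M N
  have h' : act (drinfeld φ R) (M ⊗ N) ≫ φ.app (M.A ⊗ N.A) = drinfeldMap R (M ⊗ N) :=
    act_drinfeld_app R φ (M ⊗ N)
  rw [← cancel_mono (φ.app (M.A ⊗ N.A)), Category.assoc, Category.assoc]
  erw [h']
  rw [h, φ.tensor, ← Category.assoc, tensorHom_comp_tensorHom, act_drinfeld_app, act_drinfeld_app]

/-- The Drinfeld element implements the square of the antipode, `S² = ad_u`, written without
inverses. This is the `T`-linearity of the Drinfeld isomorphism of free modules. -/
theorem Ssq_comp_Ract_drinfeld :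
    Ssq T φ ≫ Ract (drinfeld φ R) = Lact (drinfeld φ R) := by
  ext X
  have key : ∀ (e : X ⟶ T.obj X) (m : T.obj (T.obj X) ⟶ T.obj X) (w : T.obj X ⟶ T.obj X),
      T.map e ≫ m = 𝟙 (T.obj X) →
      T.map (w ≫ φ.app (T.obj X)) ≫
        T.map (lMap (T.map (lMap m) ≫ sl T (T.obj X))) ≫ sl T (lDual (T.obj X)) =
          m ≫ w ≫ φ.app (T.obj X) →
      (Ssq T φ).app X ≫ T.map (e ≫ w) ≫ m = w := by
    intro e m w he h
    have hs : T.map (lMap (T.map (lMap m) ≫ sl T (T.obj X))) ≫ sl T (lDual (T.obj X)) =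
        T.map (lMap (sl T (T.obj X))) ≫ sl T (lDual (T.obj (T.obj X))) ≫ lMap (lMap m) := by
      rw [← sl_naturality, ← T.map_comp_assoc, ← lMap_comp]
    have hφ := φ.inv_naturality m
    have hn : T.map (e ≫ w) ≫ (Ssq T φ).app (T.obj X) = (Ssq T φ).app X ≫ T.map (e ≫ w) :=
      (Ssq T φ).naturality (e ≫ w)
    have hS : (Ssq T φ).app (T.obj X) ≫ m = T.map (φ.app (T.obj X)) ≫
        (T.map (lMap (sl T (T.obj X))) ≫ sl T (lDual (T.obj (T.obj X))) ≫ lMap (lMap m)) ≫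
          inv (φ.app (T.obj X)) := by
      change (T.map (φ.app (T.obj X)) ≫ T.map (lMap (sl T (T.obj X))) ≫
        sl T (lDual (T.obj (T.obj X))) ≫ inv (φ.app (T.obj (T.obj X)))) ≫ m = _
      simp only [Category.assoc]
      rw [hφ]
    rw [← Category.assoc, ← hn, Category.assoc, hS, ← hs, ← Category.assoc, ← T.map_comp,
      Category.assoc, T.map_comp e, ← Category.assoc, Category.assoc (T.map e), h,
      ← Category.assoc, he, Category.id_comp, Category.assoc, IsIso.hom_inv_id, Category.comp_id]
  have h := drinfeldMap_linear R (freeModule T X)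
  rw [← act_drinfeld_app R φ] at h
  have hη : T.η.app X ≫ act (drinfeld φ R) (freeModule T X) = _ := η_act_free (drinfeld φ R) X
  have := key (T.η.app X) (T.μ.app X) (act (drinfeld φ R) (freeModule T X)) (T.right_unit X) h
  erw [hη] at this
  exact this

end DrinfeldElement

/-! ### Twists and sovereign elements -/

section Twists

variable {C : Type u} [Category.{v} C] [MonoidalCategory C] [RigidCategory C]
  {T : Monad C} [HopfMonad T] (φ : SovereignStructure C) (R : RMatrix T)

/-- For central `θ`, the element `u * θ` is multiplicative on tensor products exactly when `θ`
satisfies the tensor axiom of a twist. -/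
theorem twist_iff_grouplike {θ : HomUnit T} (hθ : IsCentral θ) :
    (∀ M N : T.Algebra, act θ (M ⊗ N) =
      braidMap R M N ≫ braidMap R N M ≫ (act θ M ⊗ₘ act θ N)) ↔
    ∀ M N : T.Algebra, act (drinfeld φ R * θ) (M ⊗ N) =
      (act (drinfeld φ R * θ) M ⊗ₘ act (drinfeld φ R * θ) N) := by
  refine forall₂_congr fun M N => ?_
  have hu := isIso_act (isUnit_drinfeld R φ) (M ⊗ N)
  have h : (act θ M ⊗ₘ act θ N) ≫ act (drinfeld φ R) (M ⊗ N) =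
      act (drinfeld φ R) (M ⊗ N) ≫ (act θ M ⊗ₘ act θ N) :=
    act_naturality (drinfeld φ R) (hθ.actHom M ⊗ₘ hθ.actHom N)
  have hM : act θ M ≫ act (drinfeld φ R) M = act (drinfeld φ R) M ≫ act θ M :=
    act_naturality (drinfeld φ R) (hθ.actHom M)
  have hN : act θ N ≫ act (drinfeld φ R) N = act (drinfeld φ R) N ≫ act θ N :=
    act_naturality (drinfeld φ R) (hθ.actHom N)
  have ht := act_drinfeld_tensor R φ M N
  have key : (act (drinfeld φ R * θ) M ⊗ₘ act (drinfeld φ R * θ) N) =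
      (braidMap R M N ≫ braidMap R N M ≫ (act θ M ⊗ₘ act θ N)) ≫
        act (drinfeld φ R) (M ⊗ N) := by
    rw [act_mul, act_mul, hM, hN, ← tensorHom_comp_tensorHom, ← ht]
    simp only [Category.assoc]
    rw [h]
  rw [key, act_mul]
  exact (cancel_mono _).symm

theorem isSovereignElement_of_isTwist {θ : HomUnit T} (hθ : IsTwist R θ) :
    IsSovereignElement φ (drinfeld φ R * θ) := by
  have hg : IsGrouplike (drinfeld φ R * θ) :=
    isGrouplike_of_tensor ((isUnit_drinfeld R φ).mul hθ.invertible)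
      ((grouplike_tensor_iff _).2 ((twist_iff_grouplike φ R hθ.central).1
        ((twist_tensor_iff R θ).1 hθ.tensor)))
  refine ⟨hg, (eq_ad_iff _ _).2 ?_⟩
  exact (comp_Ract_mul_iff (isUnit_drinfeld R φ).unit θ _ (Ssq_comp_Ract_drinfeld R φ)).2
    hθ.central

theorem isTwist_of_isSovereignElement {θ : HomUnit T}
    (hG : IsSovereignElement φ (drinfeld φ R * θ)) : IsTwist R θ := by
  have hc : IsCentral θ :=
    (comp_Ract_mul_iff (isUnit_drinfeld R φ).unit θ _ (Ssq_comp_Ract_drinfeld R φ)).1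
      ((eq_ad_iff _ _).1 hG.sq)
  refine ⟨hc, ?_, ?_⟩
  · exact (Units.isUnit_units_mul (isUnit_drinfeld R φ).unit θ).1 hG.grouplike.toUnit.isUnit
  · exact (twist_tensor_iff R θ).2 ((twist_iff_grouplike φ R hc).2
      ((grouplike_tensor_iff _).1 hG.grouplike.tensor))

theorem isSelfDual_iff {θ : (HomUnit T)ˣ} {u : HomUnit T} (G : (HomUnit T)ˣ)
    (hG : (G : HomUnit T) = u * θ) (hS : S (G : HomUnit T) = (↑G⁻¹ : HomUnit T)) :
    IsSelfDual (θ : HomUnit T) ↔ S u = (↑G⁻¹ : HomUnit T) * u * (↑G⁻¹ : HomUnit T) := by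
  have h : (↑G⁻¹ : HomUnit T) * u = (↑θ⁻¹ : HomUnit T) := by
    rw [Units.inv_mul_eq_iff_eq_mul, hG, mul_assoc, Units.mul_inv, mul_one]
  rw [hG, S_mul] at hS
  rw [h, IsSelfDual]
  constructor
  · intro hθ
    rw [← hS, hθ, Units.inv_mul_cancel_left]
  · intro hu
    rw [hu, ← mul_assoc] at hS
    calc
      S (θ : HomUnit T) = S (θ : HomUnit T) * ↑θ⁻¹ * ↑G⁻¹ * G * θ := by simp [mul_assoc]
      _ = θ := by rw [hS, Units.inv_mul, one_mul]

end Twists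

end

end HopfMonads

open HopfMonads
theorem mainTheorem8 {C : Type u} [Category.{v} C] [MonoidalCategory C] [RigidCategory C]
    (φ : SovereignStructure C) (T : CategoryTheory.Monad C) [HopfMonad T] (R : RMatrix T) :
    Set.BijOn (fun θ : HomUnit T => drinfeld φ R * θ)
      {θ | IsTwist R θ} {G | IsSovereignElement φ G} ∧
    ∀ θ : HomUnit T, IsTwist R θ →
      ∃ G : (HomUnit T)ˣ, (G : HomUnit T) = drinfeld φ R * θ ∧
        (IsSelfDual θ ↔
          S (drinfeld φ R) = (↑G⁻¹ : HomUnit T) * drinfeld φ R * (↑G⁻¹ : HomUnit T)) := by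
  refine ⟨⟨fun θ hθ => isSovereignElement_of_isTwist φ R hθ, ?_, fun G hG => ?_⟩, fun θ hθ => ?_⟩
  · exact ((isUnit_drinfeld R φ).mul_right_injective).injOn
  · obtain ⟨u, hu⟩ := isUnit_drinfeld R φ
    have h : drinfeld φ R * (↑u⁻¹ * G) = G := by rw [← hu, Units.mul_inv_cancel_left]
    exact ⟨↑u⁻¹ * G, isTwist_of_isSovereignElement φ R (by rwa [h]), h⟩
  · have hG := (isSovereignElement_of_isTwist φ R hθ).grouplike
    exact ⟨hG.toUnit, rfl, isSelfDual_iff (θ := hθ.invertible.unit) hG.toUnit rfl rfl⟩
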